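/- Let $d\ge 2$ be a fixed integer. The bin $d$-process on $n$ bins drops balls one by one, independently and uniformly at random, into the bins. A bin is unsaturated if it contains fewer than $d$ good balls (good balls are defined below). Balls falling into unsaturated bins are numbered $1,2,\dots$ in order of arrival, and balls falling into saturated bins stay unnumbered. For every even $j\ge2$ the balls numbered $j-1$ and $j$ form a pair. The pair and both its balls are good if the two balls lie in distinct bins and no earlier pair fell into the same two bins; otherwise they are bad. A numbered ball that is not yet paired is neither good nor bad. The good pairs are the edges of a graph on the bins (the graph $d$-process), in which the degree of a bin is its number of good balls. The deficit $T(m)$ after $m$ balls is $\lfloor dn/2\rfloor$ minus the number of good pairs present. For an integer $t\ge 0$ let $M(t)=\min\{m:T(m)=t\}$ (with $M(t)=\infty$ if there is no such $m$), and let $D_i(t)$ be the number of bins containing exactly $i$ good balls after $M(t)$ balls. Write $[x]_k=x(x-1)\cdots(x-k+1)$; all logarithms are natural and asymptotics are for $n\to\infty$. **Theorem.** Let $\gamma>d+1$ be a constant and let $t=t(n)$ be integers with $t\sim\log^\gamma n$. For $0\le i\le d-1$ set $$f_i=f_i(d,t,n)=\frac{2\,[d-1]_{d-1-i}\;t}{\log^{d-1-i}n}.$$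 Then for every $0\le i\le d-1$ and every fixed $k\ge1$: (i) for every fixed $C>0$ there is a function $\Phi(n)=o(1)$ such that, with probability $1-O(\log^{-C}n)$, the process reaches deficit $t$ and $\big|[D_i(t)]_k-f_i^k\big|\le\Phi(n)\,f_i^k$; (ii) $\mathbf E\,[D_i(t)]_k\sim f_i^k$. -/

import Mathlib

open Filter Topology MeasureTheory ProbabilityTheory Asymptotics

namespace BinProcess

/-- State of the bin process on `n` bins. `edges` is the set of (unordered) pairs of bins that
received the two balls of a good pair, that is, the edge set of the associated graph; distinct good
pairs occupy distinct pairs of bins. `waiting` is the bin containing the waiting ball, if there is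
a numbered ball that is not yet paired. Bad and unnumbered balls influence nothing later on. -/
structure State (n : ℕ) where
  edges : Finset (Sym2 (Fin n))
  waiting : Option (Fin n)

/-- The number of good balls in bin `v`: each good pair one of whose balls lies in `v` contributes
exactly one. This is the degree of `v` in the associated graph. -/
def State.degree {n : ℕ} (S : State n) (v : Fin n) : ℕ :=
  (S.edges.filter fun e => v ∈ e).card

/-- Drop the next ball into bin `v`.
* If `v` is saturated (it has at least `d` good balls), the ball stays unnumbered.
* Otherwise the ball is numbered. If no ball is waiting, it becomes the waiting ball.
* If a ball is waiting, in bin `u`, the two form a pair. The pair is good if `u ≠ v` and no earlier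
  pair fell into the same two bins (the first pair that falls into two given distinct bins is good,
  so this says that `u` and `v` are not yet joined by an edge); otherwise the pair is bad. -/
def State.drop (d : ℕ) {n : ℕ} (S : State n) (v : Fin n) : State n :=
  if d ≤ S.degree v then S
  else
    match S.waiting with
    | none => ⟨S.edges, some v⟩
    | some u =>
        if u ≠ v ∧ s(u, v) ∉ S.edges then ⟨insert s(u, v) S.edges, none⟩
        else ⟨S.edges, none⟩

/-- The state after the first `m` balls, if the `j`-th ball (`j = 0, 1, ...`) is dropped into bin
`ω j`. Once no further good pair is possible, `edges` never changes again, so stopping the process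
at that moment or not makes no difference to the quantities below. -/
def state (d : ℕ) {n : ℕ} (ω : ℕ → Fin n) : ℕ → State n
  | 0 => ⟨∅, none⟩
  | m + 1 => (state d ω m).drop d (ω m)

/-- The deficit after `m` balls: the maximum possible number `⌊dn/2⌋` of good pairs minus the
number of good pairs present. -/
def deficit (d : ℕ) {n : ℕ} (ω : ℕ → Fin n) (m : ℕ) : ℤ :=
  ((d * n / 2 : ℕ) : ℤ) - ((state d ω m).edges.card : ℤ)

/-- The number of bins with exactly `i` good balls (vertices of degree `i`) after `m` balls. -/
def degreeCount (d i : ℕ) {n : ℕ} (ω : ℕ → Fin n) (m : ℕ) : ℕ :=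
  (Finset.univ.filter fun v : Fin n => (state d ω m).degree v = i).card

/-- The process reaches deficit `t`. -/
def Reaches (d t : ℕ) {n : ℕ} (ω : ℕ → Fin n) : Prop :=
  ∃ m, deficit d ω m = t

open Classical in
/-- The degree count at deficit `t`: the number of bins with exactly `i` good balls at the first
time at which the deficit equals `t` (and `0` if this never happens, which has
probability zero when `d ^ 2 < 2 * t` and `t ≤ ⌊dn/2⌋`). -/
noncomputable def degreeCountAt (d i t : ℕ) {n : ℕ} (ω : ℕ → Fin n) : ℕ :=
  if Reaches d t ω then degreeCount d i ω (sInf {m | deficit d ω m = t}) else 0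

/-- The law of the balls: independent and uniformly distributed over the `n` bins
(for `n = 0`, where there is no bin, this is the zero measure). -/
noncomputable def ballLaw (n : ℕ) : Measure (ℕ → Fin n) :=
  Measure.infinitePi fun _ : ℕ => uniformOn (Set.univ : Set (Fin n))

/-- `2 [d-1]_{d-1-i} t / log ^ (d-1-i) n`, where `[x]_k` is the falling factorial. -/
noncomputable def f (d i t n : ℕ) : ℝ :=
  2 * ((d - 1).descFactorial (d - 1 - i) : ℝ) * (t : ℝ) / Real.log n ^ (d - 1 - i)

end BinProcess

/-! The process is compared with plain occupancy numbers, whose law is explicit. A bin with c balls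
should have min(c, d) good balls; only bad pairs and the waiting ball disturb this. So the number of
bins with at most i good balls (`lowDegree`) lies between the number with at most i balls
(`lowCount`) and that number plus 2b + 1, where b counts the bad pairs (`lowCount_le_lowDegree`,
`lowDegree_le_lowCount`).

Bad pairs are rare. As long as the deficit T is at least d², the quantity 2^b [T]_{d²} does not grow
on average (`sum_potential_drop_le`): at most d bins make a pair bad, while the deficit forces order
T/d bins that make it good and lower T. Markov's inequality gives b < log² n up to a negligible
probability (`negligible_badCount`).

Occupancy numbers concentrate. The sum over words of a product of bin weights is a coefficient of a
product of exponential generating functions, hence bounded by the product itself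
(`sum_prod_weight_le`). This yields Chernoff bounds with an extra polynomial factor. At m = n(s +
c), with s = `critTime`, the Poisson mean is asymptotic to e^{-c} f_i (`tendsto_lowMean_div`). Since
γ > d + 1, every f_i exceeds log² n by an unbounded factor, so both the Chernoff tails and the log²
n bad pairs are harmless.

Shifting the time by ±δ brackets the first moment of deficit t, because the `lowDegree` values over
i < d sum to twice the deficit, up to one (`exists_first_deficit`). Monotonicity of occupancy in
time then pins every `lowDegree` there. Since f_{i-1} = o(f_i), subtracting consecutive levels gives
D_i. The expectation follows because D_i ≤ 2t + 1 exceeds f_i by at most a power of log n, while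
failure probabilities beat every such power. -/

namespace BinProcess

/-! ### Deterministic comparison of good balls with occupancy numbers -/

section

variable {n : ℕ}

/-- The empty state. -/
def State.empty (n : ℕ) : State n := ⟨∅, none⟩

/-- The state reached from `S` by dropping the balls of a list, first ball first. -/
def run (d : ℕ) (S : State n) (l : List (Fin n)) : State n := l.foldl (State.drop d) S

/-- Dropping a ball into bin `v` completes a bad pair. -/
def IsBad (d : ℕ) (S : State n) (v : Fin n) : Prop :=
  S.degree v < d ∧ ∃ u, S.waiting = some u ∧ (u = v ∨ s(u, v) ∈ S.edges)

open Classical in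
/-- `1` if dropping a ball into bin `v` completes a bad pair, and `0` otherwise. -/
noncomputable def badStep (d : ℕ) (S : State n) (v : Fin n) : ℕ := if IsBad d S v then 1 else 0

theorem badStep_of_isBad {d : ℕ} {S : State n} {v : Fin n} (h : IsBad d S v) :
    badStep d S v = 1 := if_pos h

theorem badStep_of_not_isBad {d : ℕ} {S : State n} {v : Fin n} (h : ¬ IsBad d S v) :
    badStep d S v = 0 := if_neg h

/-- The number of bad pairs completed while the balls of a list are dropped. -/
noncomputable def badCount (d : ℕ) : State n → List (Fin n) → ℕ
  | _, [] => 0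
  | S, v :: l => badStep d S v + badCount d (S.drop d v) l

/-- `1` if a ball is waiting in bin `v`, and `0` otherwise. -/
def State.wait (S : State n) (v : Fin n) : ℕ := if S.waiting = some v then 1 else 0

/-- The first `m` balls as a list. -/
def balls (ω : ℕ → Fin n) (m : ℕ) : List (Fin n) := List.ofFn fun j : Fin m => ω j

theorem balls_succ (ω : ℕ → Fin n) (m : ℕ) : balls ω (m + 1) = balls ω m ++ [ω m] := by
  rw [balls, List.ofFn_succ', List.concat_eq_append]
  rfl

theorem run_append (d : ℕ) (S : State n) (l : List (Fin n)) (v : Fin n) :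
    run d S (l ++ [v]) = (run d S l).drop d v := by
  simp [run, List.foldl_append]

theorem state_eq_run (d : ℕ) (ω : ℕ → Fin n) (m : ℕ) :
    state d ω m = run d (State.empty n) (balls ω m) := by
  induction m with
  | zero => rfl
  | succ m ih => rw [balls_succ, run_append, ← ih]; rfl

theorem badCount_append (d : ℕ) (S : State n) (l : List (Fin n)) (v : Fin n) :
    badCount d S (l ++ [v]) = badCount d S l + badStep d (run d S l) v := by
  induction l generalizing S with
  | nil => simp [badCount, run]
  | cons w l ih => simp [badCount, ih, run, add_assoc]

/-- The invariants of a reachable state. -/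
structure State.Valid (d : ℕ) (S : State n) : Prop where
  not_isDiag : ∀ e ∈ S.edges, ¬ e.IsDiag
  degree_add_wait : ∀ v, S.degree v + S.wait v ≤ d

theorem State.Valid.degree_le {d : ℕ} {S : State n} (h : S.Valid d) (v : Fin n) :
    S.degree v ≤ d := le_trans (Nat.le_add_right _ _) (h.degree_add_wait v)

theorem drop_of_saturated {d : ℕ} {S : State n} {v : Fin n} (h : d ≤ S.degree v) :
    S.drop d v = S := by simp [State.drop, h]

theorem drop_of_none {d : ℕ} {S : State n} {v : Fin n} (h : S.degree v < d)
    (hw : S.waiting = none) : S.drop d v = ⟨S.edges, some v⟩ := by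
  simp [State.drop, h.not_ge, hw]

theorem drop_of_bad {d : ℕ} {S : State n} {u v : Fin n} (h : S.degree v < d)
    (hw : S.waiting = some u) (hb : u = v ∨ s(u, v) ∈ S.edges) :
    S.drop d v = ⟨S.edges, none⟩ := by
  have : ¬ (u ≠ v ∧ s(u, v) ∉ S.edges) := by tauto
  simp only [State.drop, h.not_ge, hw, this, if_false]

theorem drop_of_good {d : ℕ} {S : State n} {u v : Fin n} (h : S.degree v < d)
    (hw : S.waiting = some u) (hb : u ≠ v) (he : s(u, v) ∉ S.edges) :
    S.drop d v = ⟨insert s(u, v) S.edges, none⟩ := by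
  have : (u ≠ v ∧ s(u, v) ∉ S.edges) := ⟨hb, he⟩
  simp only [State.drop, h.not_ge, hw, if_pos this, if_false]

/-- A dropped ball falls into a saturated bin, starts to wait, or completes a bad or a good pair. -/
theorem drop_cases (d : ℕ) (S : State n) (v : Fin n) :
    (d ≤ S.degree v ∧ ¬ IsBad d S v ∧ S.drop d v = S) ∨
    (S.degree v < d ∧ S.waiting = none ∧ ¬ IsBad d S v ∧ S.drop d v = ⟨S.edges, some v⟩) ∨
    (∃ u, S.degree v < d ∧ S.waiting = some u ∧ IsBad d S v ∧ S.drop d v = ⟨S.edges, none⟩) ∨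
    (∃ u, S.degree v < d ∧ S.waiting = some u ∧ ¬ IsBad d S v ∧ u ≠ v ∧ s(u, v) ∉ S.edges ∧
      S.drop d v = ⟨insert s(u, v) S.edges, none⟩) := by
  rcases le_or_gt d (S.degree v) with h | h
  · exact Or.inl ⟨h, fun hb => absurd hb.1 h.not_gt, drop_of_saturated h⟩
  right
  cases hw : S.waiting with
  | none => exact Or.inl ⟨h, rfl, by simp [IsBad, hw], drop_of_none h hw⟩
  | some u =>
    right
    by_cases hb : u = v ∨ s(u, v) ∈ S.edges
    · exact Or.inl ⟨u, h, rfl, ⟨h, u, hw, hb⟩, drop_of_bad h hw hb⟩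
    · right
      have hb' := not_or.1 hb
      refine ⟨u, h, rfl, ?_, hb'.1, hb'.2, drop_of_good h hw hb'.1 hb'.2⟩
      rintro ⟨-, u', hu', h'⟩
      obtain rfl : u = u' := by simpa [hw] using hu'
      exact hb h'

theorem degree_insert {E : Finset (Sym2 (Fin n))} {u v : Fin n} (he : s(u, v) ∉ E) (w : Fin n)
    (o o' : Option (Fin n)) :
    State.degree ⟨insert s(u, v) E, o⟩ w
      = State.degree ⟨E, o'⟩ w + if w = u ∨ w = v then 1 else 0 := by
  unfold State.degree
  simp only [Finset.filter_insert, Sym2.mem_iff]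
  split_ifs with h
  · rw [Finset.card_insert_of_notMem (by simp [he])]
  · simp

theorem Valid_empty (d : ℕ) : (State.empty n).Valid d where
  not_isDiag := by simp [State.empty]
  degree_add_wait := by simp [State.empty, State.degree, State.wait]

theorem State.Valid.drop {d : ℕ} {S : State n} (h : S.Valid d) (v : Fin n) :
    (S.drop d v).Valid d := by
  obtain ⟨E, o⟩ := S
  rcases drop_cases d ⟨E, o⟩ v with ⟨-, -, e⟩ | ⟨hv, hw, -, e⟩ | ⟨u, hv, hw, -, e⟩ |
    ⟨u, hv, hw, -, huv, he, e⟩ <;> rw [e]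
  · exact h
  · refine ⟨h.1, fun w => ?_⟩
    have h1 := h.degree_le w
    have h2 : State.degree ⟨E, some v⟩ w = State.degree ⟨E, o⟩ w := rfl
    simp only [State.wait, Option.some.injEq]
    split_ifs with hvw
    · subst hvw; omega
    · omega
  · refine ⟨h.1, fun w => ?_⟩
    have h1 := h.degree_le w
    have h2 : State.degree ⟨E, none⟩ w = State.degree ⟨E, o⟩ w := rfl
    simp [State.wait, h2, h1]
  · refine ⟨?_, fun w => ?_⟩
    · intro e' he'
      rcases Finset.mem_insert.1 he' with rfl | he'
      · simpa using huv
      · exact h.1 _ he'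
    · have h1 := h.degree_add_wait w
      rw [degree_insert he w none o]
      obtain rfl : o = some u := hw
      simp only [State.wait, Option.some.injEq] at h1 ⊢
      have h3 := h.degree_le w
      rcases eq_or_ne w v with rfl | hwv
      · simp [huv] at h1 ⊢
        omega
      · rcases eq_or_ne w u with rfl | hwu
        · simp at h1 ⊢
          omega
        · simpa [hwv, hwu] using h3

theorem Valid_run {d : ℕ} {S : State n} (h : S.Valid d) (l : List (Fin n)) :
    (run d S l).Valid d := by
  induction l generalizing S with
  | nil => exact h
  | cons v l ih => exact ih (h.drop v)

theorem sum_degree {d : ℕ} {S : State n} (h : S.Valid d) :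
    ∑ v, S.degree v = 2 * S.edges.card := by
  unfold State.degree
  have := Finset.sum_card_bipartiteAbove_eq_sum_card_bipartiteBelow
    (s := (Finset.univ : Finset (Fin n))) (t := S.edges) (fun v e => v ∈ e)
  simp only [Finset.bipartiteAbove, Finset.bipartiteBelow] at this
  rw [this, mul_comm, Finset.sum_const_nat]
  intro e he
  rw [← Sym2.card_toFinset_of_not_isDiag e (h.1 e he)]
  congr 1
  ext v
  simp

/-- Good balls and the waiting ball are distinct balls lying in the bin; a ball adds at most one to
the left side, and only in its own bin. -/
theorem degree_add_wait_le_count (d : ℕ) (l : List (Fin n)) (v : Fin n) :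
    (run d (State.empty n) l).degree v + (run d (State.empty n) l).wait v ≤ l.count v := by
  induction l using List.reverseRecOn with
  | nil => simp [run, State.empty, State.degree, State.wait]
  | append_singleton l w ih =>
    rw [run_append, List.count_append]
    generalize run d (State.empty n) l = S at ih ⊢
    obtain ⟨E, o⟩ := S
    have hc : List.count v [w] = if w = v then 1 else 0 := by
      simp [List.count_singleton]
    rw [hc]
    have hd : ∀ o', State.degree ⟨E, o'⟩ v = State.degree ⟨E, o⟩ v := fun _ => rfl
    rcases drop_cases d ⟨E, o⟩ w with ⟨-, -, e⟩ | ⟨hv, hw, -, e⟩ | ⟨u, hv, hw, -, e⟩ |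
      ⟨u, hv, hw, -, huv, he, e⟩ <;> rw [e]
    · omega
    · rw [hd]
      simp only [State.wait, Option.some.injEq] at ih ⊢
      split_ifs <;> omega
    · rw [hd]
      simp only [State.wait] at ih ⊢
      simp
      omega
    · rw [degree_insert he v none o]
      have hw' : o = some u := hw
      simp only [State.wait, hw', Option.some.injEq] at ih ⊢
      split_ifs at ih ⊢ <;> simp_all
      omega

/-- The left side grows only when a ball enters a bin with fewer than d balls. Such a bin is
unsaturated, so the ball is numbered, and every numbered ball belongs to a good pair, a bad pair, or
is waiting. -/
theorem sum_min_count_le (d : ℕ) (l : List (Fin n)) :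
    ∑ v, min (l.count v) d ≤ 2 * (run d (State.empty n) l).edges.card
      + 2 * badCount d (State.empty n) l + if (run d (State.empty n) l).waiting = none then 0 else 1 := by
  induction l using List.reverseRecOn with
  | nil => simp
  | append_singleton l w ih =>
    have hN := degree_add_wait_le_count d l w
    rw [run_append, badCount_append]
    generalize run d (State.empty n) l = S at ih hN ⊢
    have hsum : ∑ v, min ((l ++ [w]).count v) d
        ≤ ∑ v, min (l.count v) d + if S.degree w < d then 1 else 0 := by
      have : (if S.degree w < d then 1 else 0)
          = ∑ v, if v = w then (if S.degree w < d then 1 else 0) else 0 := by simp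
      rw [this, ← Finset.sum_add_distrib]
      refine Finset.sum_le_sum fun v _ => ?_
      simp only [List.count_append, List.count_singleton, beq_iff_eq]
      by_cases hvw : v = w
      · subst hvw
        simp only [if_true]
        split_ifs <;> omega
      · simp [hvw, Ne.symm hvw]
    obtain ⟨E, o⟩ := S
    rcases drop_cases d ⟨E, o⟩ w with ⟨h, hb, e⟩ | ⟨hv, hw, hb, e⟩ | ⟨u, hv, hw, hb, e⟩ |
      ⟨u, hv, hw, hb, huv, he, e⟩ <;> rw [e]
    · rw [badStep_of_not_isBad hb]
      rw [if_neg h.not_gt] at hsum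
      omega
    · rw [badStep_of_not_isBad hb]
      rw [if_pos hv] at hsum
      rw [if_pos hw] at ih
      simp only [reduceCtorEq, if_false]
      dsimp only at ih
      omega
    · rw [badStep_of_isBad hb]
      rw [if_pos hv] at hsum
      rw [if_neg (by rw [hw]; simp)] at ih
      simp only [if_true]
      dsimp only at ih
      omega
    · rw [badStep_of_not_isBad hb]
      rw [if_pos hv] at hsum
      rw [if_neg (by rw [hw]; simp)] at ih
      simp only [if_true, Finset.card_insert_of_notMem he]
      dsimp only at ih
      omega

/-- The number of bins with at most `i` balls. -/
def lowCount (i : ℕ) (l : List (Fin n)) : ℕ := (Finset.univ.filter fun v => l.count v ≤ i).card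

/-- The number of bins with at most `i` good balls. -/
def State.lowDegree (S : State n) (i : ℕ) : ℕ := (Finset.univ.filter fun v => S.degree v ≤ i).card

theorem sum_card_le_eq {ι : Type*} [Fintype ι] (d : ℕ) (g : ι → ℕ) :
    ∑ i ∈ Finset.range d, (Finset.univ.filter fun v => g v ≤ i).card = ∑ v, (d - g v) := by
  simp only [Finset.card_filter]
  rw [Finset.sum_comm]
  refine Finset.sum_congr rfl fun v _ => ?_
  rw [← Finset.card_filter]
  have : (Finset.range d).filter (fun i => g v ≤ i) = Finset.Ico (g v) d := by
    ext; simp; omega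
  rw [this, Nat.card_Ico]

/-- Layer-cake summation turns the counts into the total number of missing good balls, which is
twice the deficit up to the parity of dn. -/
theorem sum_lowDegree {d : ℕ} {S : State n} (h : S.Valid d) :
    ∑ i ∈ Finset.range d, S.lowDegree i + 2 * S.edges.card = d * n := by
  unfold State.lowDegree
  rw [sum_card_le_eq, ← sum_degree h, ← Finset.sum_add_distrib]
  rw [Finset.sum_congr rfl (fun v _ => Nat.sub_add_cancel (h.degree_le v))]
  simp [mul_comm]

theorem lowCount_le_lowDegree (d i : ℕ) (l : List (Fin n)) :
    lowCount i l ≤ (run d (State.empty n) l).lowDegree i := by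
  refine Finset.card_le_card fun v => ?_
  have := degree_add_wait_le_count d l v
  simp
  omega

theorem lowDegree_le_lowCount {d i : ℕ} (hi : i < d) (l : List (Fin n)) :
    (run d (State.empty n) l).lowDegree i
      ≤ lowCount i l + (2 * badCount d (State.empty n) l + 1) := by
  have h1 := sum_min_count_le d l
  have hV := Valid_run (Valid_empty d) l
  have h2 := sum_degree hV
  have hN := fun v => degree_add_wait_le_count d l v
  set S := run d (State.empty n) l
  have h3 : ∑ v, S.degree v + ∑ v, (min (l.count v) d - S.degree v) = ∑ v, min (l.count v) d := by
    rw [← Finset.sum_add_distrib]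
    refine Finset.sum_congr rfl fun v _ => ?_
    have := hN v
    have := hV.degree_le v
    omega
  -- A bin with degree at most i but more than i balls has `min count d` above its degree, as i < d;
  -- it contributes at least one to the total discrepancy.
  have h4 : S.lowDegree i ≤ lowCount i l + ∑ v, (min (l.count v) d - S.degree v) := by
    unfold State.lowDegree lowCount
    rw [Finset.card_filter, Finset.card_filter, ← Finset.sum_add_distrib]
    refine Finset.sum_le_sum fun v _ => ?_
    split_ifs <;> omega
  split_ifs at h1 <;> omega

/-- Bounds the deficit from above by occupancy alone, apart from bad pairs; this shows that deficit
t is reached in time. -/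
theorem dn_le_sum_lowCount (d : ℕ) (l : List (Fin n)) :
    d * n ≤ ∑ i ∈ Finset.range d, lowCount i l + 2 * (run d (State.empty n) l).edges.card
      + 2 * badCount d (State.empty n) l + 1 := by
  have h1 := sum_min_count_le d l
  have h2 : ∑ i ∈ Finset.range d, lowCount i l + ∑ v, min (l.count v) d = d * n := by
    unfold lowCount
    rw [sum_card_le_eq, ← Finset.sum_add_distrib]
    have : ∀ v ∈ (Finset.univ : Finset (Fin n)), d - l.count v + min (l.count v) d = d := by
      intro v _
      omega
    rw [Finset.sum_congr rfl this]
    simp [mul_comm]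
  split_ifs at h1 <;> omega

theorem lowCount_anti {i : ℕ} {l l' : List (Fin n)} (h : ∀ v, l.count v ≤ l'.count v) :
    lowCount i l' ≤ lowCount i l := by
  refine Finset.card_le_card fun v => ?_
  have := h v
  simp
  omega

theorem count_balls_mono (ω : ℕ → Fin n) (v : Fin n) : Monotone fun m => (balls ω m).count v :=
  monotone_nat_of_le_succ fun m => by simp [balls_succ, List.count_append]

/-! ### Exponential moment of the number of bad pairs -/

theorem sum_ofFn_succ {M : Type*} [AddCommMonoid M] (m : ℕ) (F : List (Fin n) → M) :
    ∑ x : Fin (m + 1) → Fin n, F (List.ofFn x)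
      = ∑ v, ∑ x : Fin m → Fin n, F (v :: List.ofFn x) := by
  rw [← (Fin.consEquiv fun _ => Fin n).sum_comp, Fintype.sum_prod_type]
  simp [Fin.consEquiv]

/-- The deficit of a state. -/
def State.deficit (d : ℕ) (S : State n) : ℕ := d * n / 2 - S.edges.card

theorem deficit_le_of_subset {d : ℕ} {S S' : State n} (h : S.edges ⊆ S'.edges) :
    S'.deficit d ≤ S.deficit d := Nat.sub_le_sub_left (Finset.card_le_card h) _

theorem edges_subset_drop (d : ℕ) (S : State n) (v : Fin n) : S.edges ⊆ (S.drop d v).edges := by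
  rcases drop_cases d S v with ⟨-, -, e⟩ | ⟨-, -, -, e⟩ | ⟨u, -, -, -, e⟩ |
      ⟨u, -, -, -, -, -, e⟩ <;> rw [e]
  exact Finset.subset_insert _ _

theorem two_mul_deficit_le {d : ℕ} {S : State n} (h : S.Valid d) :
    2 * S.deficit d ≤ d * (Finset.univ.filter fun v => S.degree v < d).card := by
  have h1 := sum_lowDegree h
  have h2 : ∑ i ∈ Finset.range d, S.lowDegree i
      ≤ d * (Finset.univ.filter fun v => S.degree v < d).card := by
    rw [← smul_eq_mul]
    refine (Finset.sum_le_card_nsmul _ _ _ fun i hi => ?_).trans_eq (by rw [Finset.card_range])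
    refine Finset.card_le_card fun v => ?_
    have := Finset.mem_range.1 hi
    simp
    omega
  have h3 : d * n / 2 * 2 ≤ d * n := Nat.div_mul_le_self _ _
  unfold State.deficit
  omega

-- With a ball waiting in u, only u and its neighbours are bad choices. The waiting ball itself
-- forces the degree of u to be at most d - 1.
open Classical in
theorem card_isBad_le {d : ℕ} {S : State n} (h : S.Valid d) :
    (Finset.univ.filter fun v => IsBad d S v).card ≤ d := by
  cases hw : S.waiting with
  | none => simp [IsBad, hw]
  | some u =>
    have hsub : (Finset.univ.filter fun v => IsBad d S v)
        ⊆ insert u (Finset.univ.filter fun v => s(u, v) ∈ S.edges) := by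
      intro v
      simp only [IsBad, hw, Finset.mem_filter, Finset.mem_univ, true_and, Finset.mem_insert]
      rintro ⟨-, u', hu', h'⟩
      cases hu'
      exact h'.imp Eq.symm id
    have h1 : (Finset.univ.filter fun v => s(u, v) ∈ S.edges).card ≤ S.degree u := by
      refine Finset.card_le_card_of_injOn (fun v => s(u, v)) ?_ ?_
      · intro v hv
        simpa using hv
      · intro v _ w _ hvw
        exact Sym2.congr_right.1 hvw
    have h2 := h.degree_add_wait u
    rw [State.wait, if_pos hw] at h2
    exact (Finset.card_le_card hsub).trans ((Finset.card_insert_le _ _).trans (by omega))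

/-- One-step supermartingale property. A bad pair doubles the potential; a good pair multiplies it
by 1 - d²/T. The order d² of the falling factorial is what makes the gain from at most d bad bins no
larger than the loss from at least T/d good ones. -/
theorem sum_potential_drop_le {d : ℕ} (hd : 1 ≤ d) {S : State n} (h : S.Valid d) :
    ∑ v, 2 ^ badStep d S v * ((S.drop d v).deficit d).descFactorial (d ^ 2)
      ≤ n * (S.deficit d).descFactorial (d ^ 2) := by
  classical
  set T := S.deficit d with hT
  set k := d ^ 2 with hk
  have hk1 : 1 ≤ k := Nat.one_le_pow _ _ hd
  rcases lt_or_ge T k with hTk | hTk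
  · refine (Finset.sum_eq_zero fun v _ => ?_).trans_le (Nat.zero_le _)
    rw [Nat.descFactorial_of_lt, mul_zero]
    exact (deficit_le_of_subset (edges_subset_drop d S v)).trans_lt hTk
  cases hw : S.waiting with
  | none =>
    refine (Finset.sum_le_card_nsmul _ _ (T.descFactorial k) fun v _ => ?_).trans_eq (by simp)
    rcases drop_cases d S v with ⟨-, hb, e⟩ | ⟨-, -, hb, e⟩ | ⟨u, -, hw', -, e⟩ |
      ⟨u, -, hw', -, -, -, e⟩
    · rw [e, badStep_of_not_isBad hb]; simp [hT]
    · rw [e, badStep_of_not_isBad hb]; simp [hT, State.deficit]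
    · simp [hw] at hw'
    · simp [hw] at hw'
  | some u =>
    set H := T.descFactorial k
    set H' := (T - 1).descFactorial k
    have hHH : H' ≤ H := Nat.descFactorial_le k (Nat.sub_le T 1)
    have hrec : (T - k) * H = T * H' := by
      have := Nat.succ_descFactorial (T - 1) k
      rwa [Nat.sub_add_cancel (hk1.trans hTk)] at this
    set A := Finset.univ.filter fun v => S.degree v < d
    set Bd := Finset.univ.filter fun v => IsBad d S v
    set G := Finset.univ.filter fun v => S.degree v < d ∧ ¬ IsBad d S v
    have hA : A.card = Bd.card + G.card := by
      rw [← Finset.card_union_of_disjoint]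
      · congr 1
        ext v
        simp only [A, Bd, G, Finset.mem_filter, Finset.mem_univ, true_and, Finset.mem_union]
        have : IsBad d S v → S.degree v < d := fun hb => hb.1
        tauto
      · rw [Finset.disjoint_filter]
        tauto
    -- Each bin keeps H, gains H if bad, and loses H - H' if good; the loss is moved to the left to
    -- avoid truncated subtraction.
    have hterm : ∀ v ∈ (Finset.univ : Finset (Fin n)),
        2 ^ badStep d S v * ((S.drop d v).deficit d).descFactorial k
          + (if S.degree v < d ∧ ¬ IsBad d S v then H - H' else 0)
          = H + if IsBad d S v then H else 0 := by
      intro v _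
      rcases drop_cases d S v with ⟨hv, hb, e⟩ | ⟨-, hw', -, e⟩ | ⟨u, hv, -, hb, e⟩ |
        ⟨u, hv, -, hb, -, he, e⟩
      · rw [e, badStep_of_not_isBad hb, if_neg hb, if_neg (by omega)]
        simp [H, hT]
      · simp [hw] at hw'
      · rw [e, badStep_of_isBad hb, if_pos hb, if_neg (by tauto)]
        have : State.deficit d ⟨S.edges, none⟩ = T := rfl
        rw [this]
        simp only [pow_one, H]
        omega
      · rw [e, badStep_of_not_isBad hb, if_neg hb, if_pos ⟨hv, hb⟩]
        have : State.deficit d ⟨insert s(u, v) S.edges, none⟩ = T - 1 := by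
          rw [hT, State.deficit, State.deficit, Finset.card_insert_of_notMem he]
          omega
        rw [this]
        simp only [pow_zero, one_mul, add_zero]
        omega
    have hsum := Finset.sum_congr rfl hterm
    rw [Finset.sum_add_distrib, Finset.sum_add_distrib, ← Finset.sum_filter, ← Finset.sum_filter]
      at hsum
    simp only [Finset.sum_const, smul_eq_mul, Finset.card_univ, Fintype.card_fin] at hsum
    have hcard : T * Bd.card ≤ G.card * k := by
      have h1 : Bd.card ≤ d := card_isBad_le h
      have h2 : 2 * T ≤ d * A.card := two_mul_deficit_le h
      rw [hA] at h2
      -- From 2T ≤ d(|Bd| + |G|) and |Bd| ≤ d, with d² ≤ T absorbing the bad bins.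
      have h3 : T ≤ d * G.card := by nlinarith
      calc T * Bd.card ≤ (d * G.card) * d := Nat.mul_le_mul h3 h1
        _ = G.card * k := by rw [hk]; ring
    have hkey : Bd.card * H ≤ G.card * (H - H') := by
      have hTpos : 0 < T := hk1.trans hTk
      refine le_of_mul_le_mul_left ?_ hTpos
      have : T * (H - H') = k * H := by
        rw [Nat.mul_sub, ← hrec, Nat.sub_mul]
        have := Nat.mul_le_mul_right H hTk
        omega
      calc T * (Bd.card * H) = T * Bd.card * H := by ring
        _ ≤ G.card * k * H := Nat.mul_le_mul_right _ hcard
        _ = T * (G.card * (H - H')) := by rw [mul_left_comm, this]; ring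
    change _ + G.card * (H - H') = n * H + Bd.card * H at hsum
    omega

/-- The exponential moment of the number of bad pairs, weighted by a falling factorial of the
deficit. -/
theorem sum_potential_le {d : ℕ} (hd : 1 ≤ d) {S : State n} (h : S.Valid d) (m : ℕ) :
    ∑ x : Fin m → Fin n, 2 ^ badCount d S (List.ofFn x)
        * ((run d S (List.ofFn x)).deficit d).descFactorial (d ^ 2)
      ≤ n ^ m * (S.deficit d).descFactorial (d ^ 2) := by
  induction m generalizing S with
  | zero => simp [badCount, run]
  | succ m ih =>
    rw [sum_ofFn_succ m fun l => 2 ^ badCount d S l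
      * ((run d S l).deficit d).descFactorial (d ^ 2)]
    calc ∑ v, ∑ x : Fin m → Fin n, 2 ^ badCount d S (v :: List.ofFn x)
          * ((run d S (v :: List.ofFn x)).deficit d).descFactorial (d ^ 2)
        = ∑ v, 2 ^ badStep d S v * ∑ x : Fin m → Fin n, 2 ^ badCount d (S.drop d v) (List.ofFn x)
          * ((run d (S.drop d v) (List.ofFn x)).deficit d).descFactorial (d ^ 2) := by
          refine Finset.sum_congr rfl fun v _ => ?_
          rw [Finset.mul_sum]
          refine Finset.sum_congr rfl fun x _ => ?_
          rw [badCount, pow_add, mul_assoc]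
          rfl
      _ ≤ ∑ v, 2 ^ badStep d S v
            * (n ^ m * ((S.drop d v).deficit d).descFactorial (d ^ 2)) :=
          Finset.sum_le_sum fun v _ => Nat.mul_le_mul_left _ (ih (h.drop v))
      _ = n ^ m * ∑ v, 2 ^ badStep d S v * ((S.drop d v).deficit d).descFactorial (d ^ 2) := by
          rw [Finset.mul_sum]
          exact Finset.sum_congr rfl fun v _ => by ring
      _ ≤ n ^ m * (n * (S.deficit d).descFactorial (d ^ 2)) :=
          Nat.mul_le_mul_left _ (sum_potential_drop_le hd h)
      _ = n ^ (m + 1) * (S.deficit d).descFactorial (d ^ 2) := by ring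

/-- Few words of length `m` produce `b` bad pairs before the deficit drops below `d ^ 2`. -/
theorem card_badCount_ge {d : ℕ} (hd : 1 ≤ d) (m b : ℕ) :
    (Finset.univ.filter fun x : Fin m → Fin n =>
      b ≤ badCount d (State.empty n) (List.ofFn x) ∧
        d ^ 2 ≤ (run d (State.empty n) (List.ofFn x)).deficit d).card * 2 ^ b
      ≤ n ^ m * (d * n) ^ d ^ 2 := by
  refine le_trans ?_ ((sum_potential_le hd (Valid_empty d) m).trans
    (Nat.mul_le_mul_left _ ((Nat.descFactorial_le_pow _ _).trans
      (Nat.pow_le_pow_left ((Nat.sub_le _ _).trans (Nat.div_le_self _ _)) _))))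
  rw [← smul_eq_mul]
  refine (Finset.card_nsmul_le_sum _ _ _ ?_).trans
    (Finset.sum_le_sum_of_subset (Finset.filter_subset _ _))
  intro x hx
  obtain ⟨h1, h2⟩ := (Finset.mem_filter.1 hx).2
  -- Markov's inequality: a deficit of at least d² makes the falling factorial at least 1.
  calc 2 ^ b = 2 ^ b * 1 := (mul_one _).symm
    _ ≤ _ := Nat.mul_le_mul (Nat.pow_le_pow_right (by norm_num) h1)
      (Nat.descFactorial_pos.2 h2)

/-! ### Poisson comparison and Chernoff bounds for occupancy -/

/-- The Poisson partial sum `∑ j < r, s ^ j / j!`. -/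
noncomputable def expPartial (r : ℕ) (s : ℝ) : ℝ := ∑ j ∈ Finset.range r, s ^ j / (j.factorial : ℝ)

theorem hasDerivAt_pow_div_factorial (j : ℕ) (s : ℝ) :
    HasDerivAt (fun s : ℝ => s ^ (j + 1) / ((j + 1).factorial : ℝ)) (s ^ j / (j.factorial : ℝ)) s := by
  refine ((hasDerivAt_pow (j + 1) s).div_const ((j + 1).factorial : ℝ)).congr_deriv ?_
  rw [Nat.factorial_succ]
  push_cast
  have : (j.factorial : ℝ) ≠ 0 := by positivity
  field_simp

/-- The truncated `r - 1` is right at r = 0 as well, since the empty partial sum is zero. -/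
theorem hasDerivAt_expPartial (r : ℕ) (s : ℝ) :
    HasDerivAt (expPartial r) (expPartial (r - 1) s) s := by
  cases r with
  | zero =>
    have h : expPartial 0 = fun _ => (0 : ℝ) := by
      funext s
      simp [expPartial]
    rw [h]
    exact hasDerivAt_const s (0 : ℝ)
  | succ r =>
    have h : expPartial (r + 1) = fun s => (∑ j ∈ Finset.range r, s ^ (j + 1) / ((j + 1).factorial : ℝ)) + 1 := by
      funext s
      simp [expPartial, Finset.sum_range_succ']
    rw [h]
    refine HasDerivAt.add_const _ ?_
    exact HasDerivAt.fun_sum fun j _ => hasDerivAt_pow_div_factorial j s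

/-- The exponential generating function of the weights `1 + a * 1_{j < r}`. -/
noncomputable def weightGen (a : ℝ) (r : ℕ) (s : ℝ) : ℝ := Real.exp s + a * expPartial r s

theorem hasDerivAt_weightGen (a : ℝ) (r : ℕ) (s : ℝ) :
    HasDerivAt (weightGen a r) (weightGen a (r - 1) s) s :=
  (Real.hasDerivAt_exp s).add ((hasDerivAt_expPartial r s).const_mul a)

theorem le_weightGen {a : ℝ} (ha : -1 ≤ a) (r : ℕ) {s : ℝ} (hs : 0 ≤ s) :
    1 + a * (if 0 < r then 1 else 0) ≤ weightGen a r s := by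
  unfold weightGen
  cases r with
  | zero => simpa [expPartial] using hs
  | succ r =>
    have h1 : expPartial (r + 1) s ≤ Real.exp s := Real.sum_le_exp_of_nonneg hs _
    have h2 : 1 ≤ expPartial (r + 1) s := by
      rw [expPartial, Finset.sum_range_succ']
      have : 0 ≤ ∑ k ∈ Finset.range r, s ^ (k + 1) / ((k + 1).factorial : ℝ) :=
        Finset.sum_nonneg fun _ _ => by positivity
      simpa using this
    simp
    nlinarith

theorem one_add_ite_nonneg {a : ℝ} (ha : -1 ≤ a) (p : Prop) [Decidable p] :
    0 ≤ 1 + a * (if p then 1 else 0) := by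
  split_ifs <;> linarith

/-- Comparison of the occupancy numbers of `m` balls with independent Poisson variables. -/
theorem sum_prod_weight_le {a : ℝ} (ha : -1 ≤ a) (m : ℕ) (r : Fin n → ℕ) {s : ℝ} (hs : 0 ≤ s) :
    s ^ m / (m.factorial : ℝ) * ∑ x : Fin m → Fin n,
        ∏ v, (1 + a * if (List.ofFn x).count v < r v then 1 else 0)
      ≤ ∏ v, weightGen a (r v) s := by
  induction m generalizing r s with
  | zero =>
    simp only [pow_zero, Nat.factorial_zero, Nat.cast_one, div_one, one_mul, List.ofFn_zero,
      List.count_nil, Finset.univ_unique, Finset.sum_singleton]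
    exact Finset.prod_le_prod (fun v _ => one_add_ite_nonneg ha _) fun v _ => le_weightGen ha _ hs
  | succ m ih =>
    -- Splitting off the first ball, in bin u, lowers the threshold of u by one; a threshold 0 stays
    -- 0.
    have hrec : ∑ x : Fin (m + 1) → Fin n,
          ∏ v, (1 + a * if (List.ofFn x).count v < r v then 1 else 0)
        = ∑ u, ∑ x : Fin m → Fin n, ∏ v, (1 + a * if (List.ofFn x).count v
            < Function.update r u (r u - 1) v then 1 else 0) := by
      rw [sum_ofFn_succ m fun l => ∏ v, (1 + a * if l.count v < r v then (1 : ℝ) else 0)]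
      refine Finset.sum_congr rfl fun u _ => Finset.sum_congr rfl fun x _ =>
        Finset.prod_congr rfl fun v _ => ?_
      congr 2
      refine if_congr ?_ rfl rfl
      rw [List.count_cons]
      rcases eq_or_ne v u with rfl | h
      · simp
        omega
      · simp [h, h.symm]
    set A := ∑ x : Fin (m + 1) → Fin n,
      ∏ v, (1 + a * if (List.ofFn x).count v < r v then (1 : ℝ) else 0) with hA
    -- The inequality says F ≥ 0. By the product rule, F' is a sum over u of the inequalities for m
    -- with the lowered thresholds, so F is increasing from F 0 ≥ 0.
    let F : ℝ → ℝ := fun s => ∏ v, weightGen a (r v) s - s ^ (m + 1) / ((m + 1).factorial : ℝ) * A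
    have hF : ∀ s, HasDerivAt F (∑ u, (∏ v ∈ Finset.univ.erase u, weightGen a (r v) s)
        * weightGen a (r u - 1) s - s ^ m / (m.factorial : ℝ) * A) s := by
      intro s
      refine HasDerivAt.sub ?_ ((hasDerivAt_pow_div_factorial m s).mul_const A)
      simpa using HasDerivAt.fun_finsetProd (u := Finset.univ)
        (f := fun v => weightGen a (r v)) fun v _ => hasDerivAt_weightGen a (r v) s
    have hmono : MonotoneOn F (Set.Ici 0) := by
      refine monotoneOn_of_deriv_nonneg (convex_Ici 0)
        (fun s _ => (hF s).continuousAt.continuousWithinAt)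
        (fun s _ => (hF s).differentiableAt.differentiableWithinAt) fun s hs => ?_
      rw [interior_Ici, Set.mem_Ioi] at hs
      rw [(hF s).deriv, hrec, Finset.mul_sum, sub_nonneg]
      refine Finset.sum_le_sum fun u _ => (ih (Function.update r u (r u - 1)) hs.le).trans_eq ?_
      rw [← Finset.prod_erase_mul _ _ (Finset.mem_univ u)]
      simp only [Function.update_self]
      congr 1
      refine Finset.prod_congr rfl fun v hv => ?_
      rw [Function.update_of_ne (Finset.ne_of_mem_erase hv)]
    have h0 : 0 ≤ F 0 := by
      simp only [F, pow_succ, mul_zero, zero_div, zero_mul, sub_zero]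
      exact Finset.prod_nonneg fun v _ =>
        (one_add_ite_nonneg ha _).trans (le_weightGen ha (r v) le_rfl)
    have := h0.trans (hmono Set.self_mem_Ici hs hs)
    simp only [F] at this
    linarith

/-- A crude Stirling bound: fixing the total number of balls instead of a Poisson total costs only
the factor e·m. -/
theorem factorial_mul_exp_le {m : ℕ} (hm : 1 ≤ m) :
    (m.factorial : ℝ) * Real.exp m ≤ Real.exp 1 * m * (m : ℝ) ^ m := by
  induction m, hm using Nat.le_induction with
  | base => simp
  | succ m hm ih =>
    have hm0 : (0 : ℝ) < m := by exact_mod_cast hm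
    have h1 : Real.exp 1 * (m : ℝ) ^ (m + 1) ≤ ((m : ℝ) + 1) ^ (m + 1) := by
      have h2 : 1 ≤ ((m : ℝ) + 1) * Real.log (((m : ℝ) + 1) / m) := by
        have := Real.one_sub_inv_le_log_of_pos (x := ((m : ℝ) + 1) / m) (by positivity)
        calc (1 : ℝ) = ((m : ℝ) + 1) * (1 - (((m : ℝ) + 1) / m)⁻¹) := by field_simp; ring
          _ ≤ _ := by gcongr
      have h3 : Real.exp 1 ≤ (((m : ℝ) + 1) / m) ^ (m + 1) := by
        rw [← Real.exp_log (show 0 < (((m : ℝ) + 1) / m) ^ (m + 1) by positivity),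
          Real.log_pow, Real.exp_le_exp]
        push_cast
        exact h2
      calc Real.exp 1 * (m : ℝ) ^ (m + 1) ≤ (((m : ℝ) + 1) / m) ^ (m + 1) * (m : ℝ) ^ (m + 1) := by
            gcongr
        _ = ((m : ℝ) + 1) ^ (m + 1) := by rw [← mul_pow, div_mul_cancel₀ _ hm0.ne']
    rw [Nat.factorial_succ]
    push_cast
    rw [Real.exp_add]
    calc ((m : ℝ) + 1) * m.factorial * (Real.exp m * Real.exp 1)
        = ((m : ℝ) + 1) * Real.exp 1 * (m.factorial * Real.exp m) := by ring
      _ ≤ ((m : ℝ) + 1) * Real.exp 1 * (Real.exp 1 * m * (m : ℝ) ^ m) := by gcongr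
      _ = Real.exp 1 * ((m : ℝ) + 1) * (Real.exp 1 * (m : ℝ) ^ (m + 1)) := by ring
      _ ≤ Real.exp 1 * ((m : ℝ) + 1) * ((m : ℝ) + 1) ^ (m + 1) := by gcongr

/-- The approximate mean of the number of bins with at most `i` balls after `m` balls. -/
noncomputable def lowMean (n m i : ℕ) : ℝ :=
  n * Real.exp (-(m / n : ℝ)) * expPartial (i + 1) (m / n)

/-- The comparison is used at s = m/n, giving bins their true average load; 1 + x ≤ e^x then bounds
the n-th power of `weightGen`. -/
theorem sum_pow_lowCount_le {m : ℕ} (hn : 1 ≤ n) (hm : 1 ≤ m) (i : ℕ) {y : ℝ} (hy : 0 ≤ y) :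
    ∑ x : Fin m → Fin n, y ^ lowCount i (List.ofFn x)
      ≤ (n : ℝ) ^ m * (Real.exp 1 * m * Real.exp ((y - 1) * lowMean n m i)) := by
  have hn0 : (0 : ℝ) < n := by exact_mod_cast hn
  have hm0 : (0 : ℝ) < m := by exact_mod_cast hm
  set s : ℝ := m / n with hs
  have hs0 : 0 < s := by positivity
  have h1 := sum_prod_weight_le (a := y - 1) (by linarith) m (fun _ : Fin n => i + 1) hs0.le
  have h2 : ∀ x : Fin m → Fin n, ∏ v, (1 + (y - 1) * if (List.ofFn x).count v < i + 1 then 1 else 0)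
      = y ^ lowCount i (List.ofFn x) := by
    intro x
    rw [lowCount, ← Finset.prod_const, Finset.prod_filter]
    refine Finset.prod_congr rfl fun v _ => ?_
    simp only [Nat.lt_succ_iff]
    split_ifs <;> ring
  simp only [h2, Finset.prod_const, Finset.card_univ, Fintype.card_fin] at h1
  have h3 : weightGen (y - 1) (i + 1) s ^ n
      ≤ Real.exp m * Real.exp ((y - 1) * lowMean n m i) := by
    have h4 : 0 ≤ weightGen (y - 1) (i + 1) s :=
      (one_add_ite_nonneg (by linarith) _).trans (le_weightGen (by linarith) (i + 1) hs0.le)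
    have h5 : weightGen (y - 1) (i + 1) s
        ≤ Real.exp s * Real.exp ((y - 1) * (Real.exp (-s) * expPartial (i + 1) s)) := by
      have h6 := Real.add_one_le_exp ((y - 1) * (Real.exp (-s) * expPartial (i + 1) s))
      calc weightGen (y - 1) (i + 1) s
          = Real.exp s * ((y - 1) * (Real.exp (-s) * expPartial (i + 1) s) + 1) := by
            rw [weightGen, Real.exp_neg]
            field_simp
            ring
        _ ≤ _ := by gcongr
    calc weightGen (y - 1) (i + 1) s ^ n
        ≤ (Real.exp s * Real.exp ((y - 1) * (Real.exp (-s) * expPartial (i + 1) s))) ^ n := by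
          gcongr
      _ = _ := by
          rw [mul_pow, ← Real.exp_nat_mul, ← Real.exp_nat_mul, lowMean, ← hs]
          congr 2
          · rw [hs]; field_simp
          · ring
  have h7 := factorial_mul_exp_le hm
  have hf : (0 : ℝ) < m.factorial := by positivity
  set Z := ∑ x : Fin m → Fin n, y ^ lowCount i (List.ofFn x)
  have h8 : Z ≤ m.factorial / s ^ m * (Real.exp m * Real.exp ((y - 1) * lowMean n m i)) := by
    have := h1.trans h3
    calc Z = m.factorial / s ^ m * (s ^ m / m.factorial * Z) := by field_simp
      _ ≤ _ := by gcongr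
  refine h8.trans ?_
  rw [hs, div_pow]
  calc (m.factorial : ℝ) / (m ^ m / n ^ m) * (Real.exp m * Real.exp ((y - 1) * lowMean n m i))
      = n ^ m * (m.factorial * Real.exp m / m ^ m * Real.exp ((y - 1) * lowMean n m i)) := by
        field_simp
    _ ≤ n ^ m * (Real.exp 1 * m * Real.exp ((y - 1) * lowMean n m i)) := by
        gcongr
        rwa [div_le_iff₀ (by positivity)]

/-- A Chernoff bound for the number of bins with at most `i` balls. -/
theorem card_lowCount_deviation_le {m : ℕ} (hn : 1 ≤ n) (hm : 1 ≤ m) (i : ℕ) {y : ℝ} (hy : 0 < y)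
    (p : ℕ → Prop) [DecidablePred p]
    (hp : ∀ z, p z → Real.log y * (y * lowMean n m i) ≤ Real.log y * z) :
    ((Finset.univ.filter fun x : Fin m → Fin n => p (lowCount i (List.ofFn x))).card : ℝ)
      ≤ (n : ℝ) ^ m * (Real.exp 1 * m *
          Real.exp (-((y * Real.log y - y + 1) * lowMean n m i))) := by
  have h1 := sum_pow_lowCount_le hn hm i hy.le
  set E := Real.exp (Real.log y * (y * lowMean n m i))
  have h2 : ((Finset.univ.filter fun x : Fin m → Fin n => p (lowCount i (List.ofFn x))).card : ℝ) * E
      ≤ ∑ x : Fin m → Fin n, y ^ lowCount i (List.ofFn x) := by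
    rw [← nsmul_eq_mul]
    refine (Finset.card_nsmul_le_sum _ _ _ ?_).trans
      (Finset.sum_le_sum_of_subset_of_nonneg (Finset.filter_subset _ _)
        fun _ _ _ => by positivity)
    intro x hx
    have := hp _ (Finset.mem_filter.1 hx).2
    rw [← Real.rpow_natCast, Real.rpow_def_of_pos hy]
    exact Real.exp_le_exp.2 this
  have h3 := h2.trans h1
  rw [← le_div_iff₀ (Real.exp_pos _)] at h3
  refine h3.trans_eq ?_
  rw [mul_div_assoc, mul_div_assoc, ← Real.exp_sub]
  congr 3
  ring

theorem mul_log_sub_add_one_pos {y : ℝ} (hy : 0 < y) (hy1 : y ≠ 1) :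
    0 < y * Real.log y - y + 1 := by
  have h := Real.add_one_lt_exp (x := Real.log y⁻¹)
    (by rw [Real.log_inv]; simpa using Real.log_ne_zero_of_pos_of_ne_one hy hy1)
  rw [Real.exp_log (by positivity), Real.log_inv] at h
  have := mul_lt_mul_of_pos_left h hy
  rw [mul_inv_cancel₀ hy.ne'] at this
  linarith

/-! ### Transfer from counting words to the law of the balls -/

theorem isProbabilityMeasure_ballLaw (hn : 1 ≤ n) : IsProbabilityMeasure (ballLaw n) := by
  have : Nonempty (Fin n) := ⟨⟨0, hn⟩⟩
  have : IsProbabilityMeasure (uniformOn (Set.univ : Set (Fin n))) :=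
    isProbabilityMeasure_uniformOn Set.finite_univ Set.univ_nonempty
  unfold ballLaw
  infer_instance

theorem ballLaw_cylinder (hn : 1 ≤ n) {m : ℕ} (x : Fin m → Fin n) :
    ballLaw n {ω | (fun j : Fin m => ω j) = x} = ((n : ENNReal) ^ m)⁻¹ := by
  have : Nonempty (Fin n) := ⟨⟨0, hn⟩⟩
  have : IsProbabilityMeasure (uniformOn (Set.univ : Set (Fin n))) :=
    isProbabilityMeasure_uniformOn Set.finite_univ Set.univ_nonempty
  let y : ℕ → Fin n := fun j => if h : j < m then x ⟨j, h⟩ else ⟨0, hn⟩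
  have hset : {ω : ℕ → Fin n | (fun j : Fin m => ω j) = x}
      = Set.pi (Finset.range m) fun j => {y j} := by
    ext ω
    simp only [Set.mem_ofPred_eq, Set.mem_pi, Finset.coe_range, Set.mem_Iio, Set.mem_singleton_iff]
    constructor
    · intro h j hj
      simp [y, hj, ← h]
    · intro h
      funext j
      have := h j j.2
      simpa [y] using this
  rw [hset, ballLaw, Measure.infinitePi_pi _ fun j _ => MeasurableSet.singleton _]
  have h1 : ∀ j ∈ Finset.range m,
      uniformOn (Set.univ : Set (Fin n)) {y j} = ((n : ENNReal))⁻¹ := by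
    intro j _
    rw [uniformOn_univ]
    simp
  rw [Finset.prod_congr rfl h1, Finset.prod_const, Finset.card_range, ENNReal.inv_pow]

theorem ballLaw_real_mul_le (hn : 1 ≤ n) {m : ℕ} (A : (Fin m → Fin n) → Prop) [DecidablePred A] :
    (ballLaw n).real {ω | A fun j : Fin m => ω j} * (n : ℝ) ^ m
      ≤ ((Finset.univ.filter A).card : ℝ) := by
  have := isProbabilityMeasure_ballLaw hn
  have hsub : {ω : ℕ → Fin n | A fun j : Fin m => ω j}
      ⊆ ⋃ x ∈ Finset.univ.filter A, {ω | (fun j : Fin m => ω j) = x} := by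
    intro ω hω
    simp only [Set.mem_iUnion]
    exact ⟨_, by simpa using hω, rfl⟩
  have h1 := (measureReal_mono hsub (measure_ne_top (ballLaw n) _)).trans
    (measureReal_biUnion_finset_le _ _)
  have hn0 : (0 : ℝ) < n := by exact_mod_cast hn
  have h2 : ∀ x ∈ Finset.univ.filter A,
      (ballLaw n).real {ω | (fun j : Fin m => ω j) = x} = ((n : ℝ) ^ m)⁻¹ := by
    intro x _
    rw [measureReal_def, ballLaw_cylinder hn]
    simp
  rw [Finset.sum_congr rfl h2, Finset.sum_const, nsmul_eq_mul, ← div_eq_mul_inv] at h1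
  rwa [le_div_iff₀ (by positivity)] at h1

/-- The sign of `Real.log y` selects the tail: y > 1 treats counts at least y times the mean, y < 1
counts at most y times the mean. -/
theorem ballLaw_lowCount_deviation_le {m : ℕ} (hn : 1 ≤ n) (hm : 1 ≤ m) (i : ℕ) {y : ℝ}
    (hy : 0 < y) (p : ℕ → Prop)
    (hp : ∀ z, p z → Real.log y * (y * lowMean n m i) ≤ Real.log y * z) :
    (ballLaw n).real {ω | p (lowCount i (balls ω m))}
      ≤ Real.exp 1 * m * Real.exp (-((y * Real.log y - y + 1) * lowMean n m i)) := by
  classical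
  have hn0 : (0 : ℝ) < n := by exact_mod_cast hn
  have h1 := (ballLaw_real_mul_le hn fun x : Fin m → Fin n => p (lowCount i (List.ofFn x))).trans
    (card_lowCount_deviation_le hn hm i hy p hp)
  rw [mul_comm] at h1
  exact le_of_mul_le_mul_left h1 (by positivity)

theorem ballLaw_badCount_ge {d : ℕ} (hd : 1 ≤ d) (hn : 1 ≤ n) (m b : ℕ) :
    (ballLaw n).real {ω | b ≤ badCount d (State.empty n) (balls ω m) ∧
        d ^ 2 ≤ (state d ω m).deficit d}
      ≤ ((d * n : ℕ) : ℝ) ^ d ^ 2 / 2 ^ b := by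
  have hn0 : (0 : ℝ) < n := by exact_mod_cast hn
  have h1 := ballLaw_real_mul_le hn fun x : Fin m → Fin n =>
    b ≤ badCount d (State.empty n) (List.ofFn x) ∧
        d ^ 2 ≤ (run d (State.empty n) (List.ofFn x)).deficit d
  have h2 : ((Finset.univ.filter fun x : Fin m → Fin n =>
      b ≤ badCount d (State.empty n) (List.ofFn x) ∧
        d ^ 2 ≤ (run d (State.empty n) (List.ofFn x)).deficit d).card : ℝ) * 2 ^ b
      ≤ (n : ℝ) ^ m * ((d * n : ℕ) : ℝ) ^ d ^ 2 := by
    exact_mod_cast card_badCount_ge (n := n) hd m b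
  simp only [state_eq_run]
  rw [le_div_iff₀ (by positivity)]
  have h3 := (mul_le_mul_of_nonneg_right h1 (by positivity : (0 : ℝ) ≤ 2 ^ b)).trans h2
  rw [mul_right_comm, mul_comm] at h3
  exact le_of_mul_le_mul_left h3 (by positivity)

/-- The union over times is needed because the bound is applied at the random first time of deficit
t. -/
theorem ballLaw_exists_badCount_ge {d : ℕ} (hd : 1 ≤ d) (hn : 1 ≤ n) (M b : ℕ) :
    (ballLaw n).real {ω | ∃ m ≤ M, b ≤ badCount d (State.empty n) (balls ω m) ∧
        d ^ 2 ≤ (state d ω m).deficit d}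
      ≤ (M + 1) * (((d * n : ℕ) : ℝ) ^ d ^ 2 / 2 ^ b) := by
  have := isProbabilityMeasure_ballLaw hn
  have hsub : {ω : ℕ → Fin n | ∃ m ≤ M, b ≤ badCount d (State.empty n) (balls ω m) ∧
        d ^ 2 ≤ (state d ω m).deficit d}
      ⊆ ⋃ m ∈ Finset.range (M + 1), {ω | b ≤ badCount d (State.empty n) (balls ω m) ∧
        d ^ 2 ≤ (state d ω m).deficit d} := by
    rintro ω ⟨m, hm, h⟩
    simp only [Set.mem_iUnion]
    exact ⟨m, Finset.mem_range.2 (by omega), h⟩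
  refine (measureReal_mono hsub (measure_ne_top (ballLaw n) _)).trans
    ((measureReal_biUnion_finset_le _ _).trans
      ((Finset.sum_le_card_nsmul _ _ _ fun m _ => ballLaw_badCount_ge hd hn m b).trans_eq ?_))
  simp

/-! ### Measurability -/

theorem measurable_of_balls {α : Type*} [MeasurableSpace α] (m : ℕ) (F : List (Fin n) → α) :
    Measurable fun ω : ℕ → Fin n => F (balls ω m) := by
  have h1 : Measurable fun ω : ℕ → Fin n => fun j : Fin m => ω j :=
    measurable_pi_lambda _ fun j => measurable_pi_apply _
  have h2 : Measurable fun x : Fin m → Fin n => F (List.ofFn x) := measurable_of_countable _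
  exact h2.comp h1

theorem measurable_degreeCountAt (d i t : ℕ) :
    Measurable fun ω : ℕ → Fin n => degreeCountAt d i t ω := by
  have hdef : ∀ m, Measurable fun ω : ℕ → Fin n => deficit d ω m := by
    intro m
    simp only [deficit, state_eq_run]
    exact measurable_of_balls m fun l =>
      ((d * n / 2 : ℕ) : ℤ) - ((run d (State.empty n) l).edges.card : ℤ)
  have hcnt : ∀ m, Measurable fun ω : ℕ → Fin n => degreeCount d i ω m := by
    intro m
    simp only [degreeCount, state_eq_run]
    exact measurable_of_balls m fun l =>
      (Finset.univ.filter fun v => (run d (State.empty n) l).degree v = i).card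
  have hset : ∀ m, MeasurableSet {ω : ℕ → Fin n | deficit d ω m = t} := fun m =>
    hdef m (measurableSet_singleton (t : ℤ))
  have hreach : MeasurableSet {ω : ℕ → Fin n | Reaches d t ω} := by
    have : {ω : ℕ → Fin n | Reaches d t ω} = ⋃ m, {ω | deficit d ω m = t} := by
      ext; simp [Reaches]
    rw [this]
    exact MeasurableSet.iUnion hset
  have hM : ∀ m, MeasurableSet {ω : ℕ → Fin n | sInf {m | deficit d ω m = t} = m} := by
    intro m
    have h1 : Measurable fun ω : ℕ → Fin n => fun m => deficit d ω m :=
      measurable_pi_lambda _ hdef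
    -- Since `sInf ∅ = 0`, the value m = 0 also collects the sequences that never reach deficit t.
    have : {ω : ℕ → Fin n | sInf {m | deficit d ω m = t} = m}
        = ({ω | deficit d ω m = t} ∩ ⋂ j : Fin m, {ω | deficit d ω j = t}ᶜ)
          ∪ ({ω | m = 0} ∩ {ω | Reaches d t ω}ᶜ) := by
      ext ω
      simp only [Set.mem_ofPred_eq, Set.mem_union, Set.mem_inter_iff, Set.mem_iInter,
        Set.mem_compl_iff]
      constructor
      · rintro rfl
        by_cases h : Reaches d t ω
        · left
          have hne : {m | deficit d ω m = t}.Nonempty := h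
          exact ⟨Nat.sInf_mem hne, fun j hj => Nat.notMem_of_lt_sInf j.2 hj⟩
        · right
          refine ⟨?_, h⟩
          have : {m | deficit d ω m = t} = ∅ := by
            ext m
            simp only [Set.mem_ofPred_eq, Set.mem_empty_iff_false, iff_false]
            exact fun hm => h ⟨m, hm⟩
          rw [this, Nat.sInf_empty]
      · rintro (⟨h1, h2⟩ | ⟨rfl, h⟩)
        · refine le_antisymm (Nat.sInf_le h1) (le_csInf ⟨m, h1⟩ fun j hj => ?_)
          by_contra hlt
          exact h2 ⟨j, not_le.1 hlt⟩ hj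
        · have : {m | deficit d ω m = t} = ∅ := by
            ext m
            simp only [Set.mem_ofPred_eq, Set.mem_empty_iff_false, iff_false]
            exact fun hm => h ⟨m, hm⟩
          rw [this, Nat.sInf_empty]
    rw [this]
    exact ((hset m).inter (MeasurableSet.iInter fun j : Fin m => (hset j).compl)).union
      ((MeasurableSet.const _).inter hreach.compl)
  refine Measurable.ite hreach ?_ measurable_const
  refine measurable_to_countable' fun c => ?_
  have : (fun ω : ℕ → Fin n => degreeCount d i ω (sInf {m | deficit d ω m = t})) ⁻¹' {c}
      = ⋃ m, ({ω | sInf {m | deficit d ω m = t} = m} ∩ {ω | degreeCount d i ω m = c}) := by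
    ext ω
    simp
  rw [this]
  exact MeasurableSet.iUnion fun m => (hM m).inter (hcnt m (measurableSet_singleton c))

end

/-! ### Asymptotics of the means at the critical time -/

theorem tendsto_log_natCast : Tendsto (fun n : ℕ => Real.log n) atTop atTop :=
  Real.tendsto_log_atTop.comp tendsto_natCast_atTop_atTop

/-- The number of balls per bin at which the deficit is close to `log n ^ γ`. -/
noncomputable def critTime (d : ℕ) (γ : ℝ) (n : ℕ) : ℝ :=
  Real.log n - (γ - d + 1) * Real.log (Real.log n) - Real.log (2 * ((d - 1).factorial : ℝ))

theorem tendsto_critTime_div (d : ℕ) (γ : ℝ) :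
    Tendsto (fun n : ℕ => critTime d γ n / Real.log n) atTop (𝓝 1) := by
  have h1 : Tendsto (fun n : ℕ => Real.log (Real.log n) / Real.log n) atTop (𝓝 0) :=
    (Real.isLittleO_log_id_atTop.tendsto_div_nhds_zero).comp tendsto_log_natCast
  have h2 : Tendsto (fun n : ℕ => Real.log (2 * ((d - 1).factorial : ℝ)) / Real.log n)
      atTop (𝓝 0) := tendsto_log_natCast.const_div_atTop _
  have h3 := ((tendsto_const_nhds (x := (1 : ℝ))).sub (h1.const_mul (γ - d + 1))).sub h2
  simp only [mul_zero, sub_zero] at h3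
  refine h3.congr' ?_
  filter_upwards [tendsto_log_natCast.eventually_gt_atTop 0] with n hn
  rw [critTime]
  field_simp

theorem tendsto_expPartial_div {s L : ℕ → ℝ} (hL : Tendsto L atTop atTop)
    (h : Tendsto (fun n => s n / L n) atTop (𝓝 1)) (i : ℕ) :
    Tendsto (fun n => expPartial (i + 1) (s n) / L n ^ i) atTop (𝓝 (1 / (i.factorial : ℝ))) := by
  have hterm : ∀ j ∈ Finset.range (i + 1),
      Tendsto (fun n => (s n / L n) ^ j * (L n)⁻¹ ^ (i - j) / (j.factorial : ℝ)) atTop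
        (𝓝 (if j = i then 1 / (i.factorial : ℝ) else 0)) := by
    intro j hj
    have hji : j ≤ i := Nat.lt_succ_iff.1 (Finset.mem_range.1 hj)
    have h1 := ((h.pow j).mul ((tendsto_inv_atTop_zero.comp hL).pow (i - j))).div_const
      (j.factorial : ℝ)
    refine h1.trans_eq ?_
    split_ifs with hij
    · subst hij; simp
    · rw [zero_pow (by omega)]; simp
  have h2 := tendsto_finsetSum _ hterm
  rw [Finset.sum_ite_eq' _ i, if_pos (by simp)] at h2
  refine h2.congr' ?_
  filter_upwards [hL.eventually_gt_atTop 0] with n hn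
  rw [expPartial, Finset.sum_div]
  refine Finset.sum_congr rfl fun j hj => ?_
  have hji : j ≤ i := Nat.lt_succ_iff.1 (Finset.mem_range.1 hj)
  obtain ⟨k, rfl⟩ := Nat.exists_eq_add_of_le hji
  rw [Nat.add_sub_cancel_left, pow_add, div_pow, inv_pow]
  field_simp

section

variable {d : ℕ} {γ : ℝ} {t : ℕ → ℕ}

theorem tendsto_t_div (ht : (fun n : ℕ => (t n : ℝ)) ~[atTop] fun n : ℕ => Real.log n ^ γ) :
    Tendsto (fun n : ℕ => (t n : ℝ) / Real.log n ^ γ) atTop (𝓝 1) := by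
  refine (isEquivalent_iff_tendsto_one ?_).1 ht
  filter_upwards [tendsto_log_natCast.eventually_gt_atTop 0] with n hn
  exact (Real.rpow_pos_of_pos hn _).ne'

theorem eventually_t_pos (ht : (fun n : ℕ => (t n : ℝ)) ~[atTop] fun n : ℕ => Real.log n ^ γ) :
    ∀ᶠ n in atTop, 0 < (t n : ℝ) := by
  filter_upwards [(tendsto_t_div ht).eventually_const_lt one_pos,
    tendsto_log_natCast.eventually_gt_atTop 0] with n h hn
  have := Real.rpow_pos_of_pos hn γ
  exact (div_pos_iff_of_pos_right this).1 h

theorem f_nonneg (d i t n : ℕ) : 0 ≤ f d i t n := by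
  unfold f
  have := Real.log_natCast_nonneg n
  positivity

/-- At time s = `critTime` one has n e^{-s} = 2(d-1)! log^{γ-d+1} n, and the Poisson partial sum is
dominated by its top term log^i n / i!. As (d-1)!/i! = [d-1]_{d-1-i}, the product is asymptotic to
f_i; a time shift c contributes e^{-c}. -/
theorem tendsto_lowMean_div (hd : 1 ≤ d)
    (ht : (fun n : ℕ => (t n : ℝ)) ~[atTop] fun n : ℕ => Real.log n ^ γ) {i : ℕ} (hi : i ≤ d - 1)
    {m : ℕ → ℕ} {c : ℝ}
    (hm : Tendsto (fun n : ℕ => (m n : ℝ) / n - critTime d γ n) atTop (𝓝 c)) :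
    Tendsto (fun n => lowMean n (m n) i / f d i (t n) n) atTop (𝓝 (Real.exp (-c))) := by
  have hs : Tendsto (fun n : ℕ => ((m n : ℝ) / n) / Real.log n) atTop (𝓝 1) := by
    have := (hm.div_atTop tendsto_log_natCast).add (tendsto_critTime_div d γ)
    rw [zero_add] at this
    refine this.congr fun n => ?_
    rw [← add_div, sub_add_cancel]
  have h1 := tendsto_expPartial_div tendsto_log_natCast hs i
  have h2 : Tendsto (fun n : ℕ => Real.exp (-((m n : ℝ) / n - critTime d γ n))) atTop
      (𝓝 (Real.exp (-c))) := (Real.continuous_exp.tendsto _).comp hm.neg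
  have h3 := (h2.mul ((tendsto_t_div ht).inv₀ one_ne_zero)).mul (h1.const_mul (i.factorial : ℝ))
  have hif : (i.factorial : ℝ) ≠ 0 := by positivity
  rw [inv_one, mul_one, mul_one_div_cancel hif, mul_one] at h3
  refine h3.congr' ?_
  filter_upwards [tendsto_log_natCast.eventually_gt_atTop 0, eventually_t_pos ht,
    eventually_gt_atTop 0] with n hL ht0 hn
  have hn0 : (0 : ℝ) < n := by exact_mod_cast hn
  have hcrit : n * Real.exp (-((m n : ℝ) / n)) = Real.exp (-((m n : ℝ) / n - critTime d γ n))
      * (Real.log n ^ γ / Real.log n ^ (d - 1) * (2 * ((d - 1).factorial : ℝ))) := by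
    have e1 : Real.log n ^ γ / Real.log n ^ (d - 1) = Real.exp ((γ - d + 1) * Real.log (Real.log n)) := by
      rw [← Real.rpow_natCast, ← Real.rpow_sub hL, Real.rpow_def_of_pos hL, Nat.cast_sub hd]
      congr 1
      push_cast
      ring
    rw [e1, ← Real.exp_log (show (0 : ℝ) < 2 * ((d - 1).factorial : ℝ) by positivity),
      ← Real.exp_add, ← Real.exp_add]
    nth_rewrite 1 [← Real.exp_log hn0]
    rw [← Real.exp_add, critTime]
    congr 1
    ring
  rw [lowMean, hcrit, f]
  have hfac := Nat.factorial_mul_descFactorial (n := d - 1) (k := d - 1 - i) (Nat.sub_le _ _)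
  rw [Nat.sub_sub_self hi] at hfac
  have hfac' : ((d - 1).factorial : ℝ) = i.factorial * ((d - 1).descFactorial (d - 1 - i) : ℝ) := by
    exact_mod_cast hfac.symm
  have hdesc : ((d - 1).descFactorial (d - 1 - i) : ℝ) ≠ 0 := by
    intro h
    rw [h, mul_zero] at hfac'
    exact (by positivity : ((d - 1).factorial : ℝ) ≠ 0) hfac'
  have hpow : Real.log n ^ (d - 1) = Real.log n ^ (d - 1 - i) * Real.log n ^ i := by
    rw [← pow_add, Nat.sub_add_cancel hi]
  have hLγ := Real.rpow_pos_of_pos hL γ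
  rw [hfac', hpow]
  field_simp

theorem descFactorial_pos_real (d i : ℕ) : (0 : ℝ) < ((d - 1).descFactorial (d - 1 - i) : ℝ) := by
  exact_mod_cast Nat.descFactorial_pos.2 (Nat.sub_le _ _)

/-- This is where γ > d + 1 enters: f_i has order log^{γ-(d-1-i)} n, and for i = 0 the exponent
exceeds 2 exactly under that condition. -/
theorem tendsto_f_div_sq (hd : 1 ≤ d) (hγ : (d : ℝ) + 1 < γ)
    (ht : (fun n : ℕ => (t n : ℝ)) ~[atTop] fun n : ℕ => Real.log n ^ γ) (i : ℕ) :
    Tendsto (fun n => f d i (t n) n / Real.log n ^ 2) atTop atTop := by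
  have hpos : 0 < γ - (d - 1 - i : ℕ) - 2 := by
    have : ((d - 1 - i : ℕ) : ℝ) ≤ ((d - 1 : ℕ) : ℝ) := by exact_mod_cast Nat.sub_le _ _
    rw [Nat.cast_sub hd] at this
    push_cast at this
    linarith
  have h1 := (tendsto_rpow_atTop hpos).comp tendsto_log_natCast
  have h2 := (tendsto_t_div ht).const_mul (2 * ((d - 1).descFactorial (d - 1 - i) : ℝ))
  rw [mul_one] at h2
  have h3 := h2.pos_mul_atTop (by have := descFactorial_pos_real d i; positivity) h1
  refine h3.congr' ?_
  filter_upwards [tendsto_log_natCast.eventually_gt_atTop 0] with n hL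
  have hLγ := Real.rpow_pos_of_pos hL γ
  simp only [Function.comp]
  rw [Real.rpow_sub hL, Real.rpow_sub hL, Real.rpow_natCast, Real.rpow_ofNat, f]
  field_simp

theorem tendsto_f (hd : 1 ≤ d) (hγ : (d : ℝ) + 1 < γ)
    (ht : (fun n : ℕ => (t n : ℝ)) ~[atTop] fun n : ℕ => Real.log n ^ γ) (i : ℕ) :
    Tendsto (fun n => f d i (t n) n) atTop atTop := by
  have h := (tendsto_f_div_sq hd hγ ht i).atTop_mul_atTop₀
    ((tendsto_pow_atTop two_ne_zero).comp tendsto_log_natCast)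
  refine h.congr' ?_
  filter_upwards [tendsto_log_natCast.eventually_gt_atTop 0] with n hL
  simp only [Function.comp]
  field_simp

theorem tendsto_f_div_f_succ {i : ℕ} (hi : i + 1 ≤ d - 1)
    (ht : (fun n : ℕ => (t n : ℝ)) ~[atTop] fun n : ℕ => Real.log n ^ γ) :
    Tendsto (fun n => f d i (t n) n / f d (i + 1) (t n) n) atTop (𝓝 0) := by
  have h1 := tendsto_log_natCast.const_div_atTop
    (((d - 1).descFactorial (d - 1 - i) : ℝ) / ((d - 1).descFactorial (d - 1 - (i + 1)) : ℝ))
  refine h1.congr' ?_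
  filter_upwards [tendsto_log_natCast.eventually_gt_atTop 0, eventually_t_pos ht] with n hL ht0
  have a := descFactorial_pos_real d i
  have b := descFactorial_pos_real d (i + 1)
  have e : d - 1 - i = (d - 1 - (i + 1)) + 1 := by omega
  have hpow : Real.log n ^ (d - 1 - i) = Real.log n ^ (d - 1 - (i + 1)) * Real.log n := by
    rw [e, pow_succ]
  rw [f, f, hpow]
  field_simp

theorem f_pred (d t n : ℕ) : f d (d - 1) t n = 2 * t := by simp [f]

theorem tendsto_f_div_last (ht : (fun n : ℕ => (t n : ℝ)) ~[atTop] fun n : ℕ => Real.log n ^ γ)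
    {i : ℕ} (hi : i < d - 1) :
    Tendsto (fun n => f d i (t n) n / (2 * t n)) atTop (𝓝 0) := by
  have h0 : Tendsto (fun n : ℕ => 1 / Real.log n) atTop (𝓝 0) :=
    tendsto_log_natCast.const_div_atTop 1
  have h1 := (h0.pow (d - 1 - i)).const_mul ((d - 1).descFactorial (d - 1 - i) : ℝ)
  rw [zero_pow (by omega), mul_zero] at h1
  refine h1.congr' ?_
  filter_upwards [tendsto_log_natCast.eventually_gt_atTop 0, eventually_t_pos ht] with n hL ht0
  rw [f, one_div, inv_pow]
  field_simp

end

/-! ### Negligible events -/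

theorem tendsto_exp_neg_sq_mul (K p C : ℝ) {c : ℝ} (hc : 0 < c) :
    Tendsto (fun x : ℝ => K * Real.exp (p * x) * Real.exp (-(c * x ^ 2)) * x ^ C) atTop (𝓝 0) := by
  have h1 : Tendsto (fun x : ℝ => x ^ C * Real.exp (-1 * x)) atTop (𝓝 0) :=
    tendsto_rpow_mul_exp_neg_mul_atTop_nhds_zero C 1 one_pos
  have h2 : Tendsto (fun x : ℝ => Real.exp (-(x * (c * x - (p + 1))))) atTop (𝓝 0) := by
    refine Real.tendsto_exp_atBot.comp (tendsto_neg_atTop_atBot.comp ?_)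
    refine tendsto_id.atTop_mul_atTop₀ ?_
    exact tendsto_atTop_add_const_right _ _ (tendsto_id.const_mul_atTop hc)
  have h3 := (h1.mul h2).const_mul K
  simp only [mul_zero] at h3
  refine h3.congr fun x => ?_
  have : Real.exp (p * x) * Real.exp (-(c * x ^ 2))
      = Real.exp (-1 * x) * Real.exp (-(x * (c * x - (p + 1)))) := by
    rw [← Real.exp_add, ← Real.exp_add]
    congr 1
    ring
  rw [mul_assoc K, this]
  ring

/-- The probabilities of the events decay faster than every power of `log n`. -/
def Negligible (A : ∀ n, Set (ℕ → Fin n)) : Prop :=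
  ∀ C : ℝ, Tendsto (fun n => (ballLaw n).real (A n) * Real.log n ^ C) atTop (𝓝 0)

theorem log_natCast_rpow_nonneg (n : ℕ) (C : ℝ) : 0 ≤ Real.log n ^ C :=
  Real.rpow_nonneg (Real.log_natCast_nonneg n) C

theorem Negligible.of_le {A : ∀ n, Set (ℕ → Fin n)} {g : ℕ → ℝ}
    (h : ∀ᶠ n in atTop, (ballLaw n).real (A n) ≤ g n)
    (hg : ∀ C : ℝ, Tendsto (fun n => g n * Real.log n ^ C) atTop (𝓝 0)) : Negligible A := by
  intro C
  refine squeeze_zero' (.of_forall fun n => mul_nonneg measureReal_nonneg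
    (log_natCast_rpow_nonneg n C)) ?_ (hg C)
  filter_upwards [h] with n hn
  exact mul_le_mul_of_nonneg_right hn (log_natCast_rpow_nonneg n C)

theorem Negligible.mono {A B : ∀ n, Set (ℕ → Fin n)} (hB : Negligible B)
    (h : ∀ᶠ n in atTop, A n ⊆ B n) : Negligible A := by
  refine Negligible.of_le (g := fun n => (ballLaw n).real (B n)) ?_ hB
  filter_upwards [h, eventually_ge_atTop 1] with n hn hn1
  have := isProbabilityMeasure_ballLaw hn1
  exact measureReal_mono hn

theorem Negligible.union {A B : ∀ n, Set (ℕ → Fin n)} (hA : Negligible A) (hB : Negligible B) :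
    Negligible fun n => A n ∪ B n := by
  refine Negligible.of_le (g := fun n => (ballLaw n).real (A n) + (ballLaw n).real (B n)) ?_ ?_
  · exact .of_forall fun n => measureReal_union_le _ _
  · intro C
    have := (hA C).add (hB C)
    rw [add_zero] at this
    exact this.congr fun n => by ring

theorem Negligible.biUnion {ι : Type*} (s : Finset ι) {A : ι → ∀ n, Set (ℕ → Fin n)}
    (h : ∀ i ∈ s, Negligible (A i)) : Negligible fun n => ⋃ i ∈ s, A i n := by
  refine Negligible.of_le (g := fun n => ∑ i ∈ s, (ballLaw n).real (A i n)) ?_ ?_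
  · exact .of_forall fun n => measureReal_biUnion_finset_le _ _
  · intro C
    have := tendsto_finsetSum s fun i hi => h i hi C
    simp only [Finset.sum_const_zero] at this
    exact this.congr fun n => by rw [Finset.sum_mul]

theorem Negligible.eventually_le {A : ∀ n, Set (ℕ → Fin n)} (h : Negligible A) (C : ℝ) :
    ∀ᶠ n in atTop, (ballLaw n).real (A n) ≤ Real.log n ^ (-C) := by
  filter_upwards [(h C).eventually_lt_const one_pos,
    tendsto_log_natCast.eventually_gt_atTop 0] with n hn hL
  rw [Real.rpow_neg hL.le, ← one_div, le_div_iff₀ (Real.rpow_pos_of_pos hL _)]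
  exact hn.le

theorem Negligible.of_exp_le {A : ∀ n, Set (ℕ → Fin n)} {K p c : ℝ} (hc : 0 < c)
    (h : ∀ᶠ n in atTop, (ballLaw n).real (A n)
      ≤ K * Real.exp (p * Real.log n) * Real.exp (-(c * Real.log n ^ 2))) : Negligible A :=
  Negligible.of_le h fun C => (tendsto_exp_neg_sq_mul K p C hc).comp tendsto_log_natCast

section

variable {d : ℕ} {γ : ℝ} {t : ℕ → ℕ} {m : ℕ → ℕ} {c : ℝ}

theorem eventually_le_sq (hm : Tendsto (fun n : ℕ => (m n : ℝ) / n - critTime d γ n) atTop (𝓝 c)) :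
    ∀ᶠ n in atTop, 1 ≤ m n ∧ (m n : ℝ) ≤ Real.exp (2 * Real.log n) := by
  have hs : Tendsto (fun n : ℕ => ((m n : ℝ) / n) / Real.log n) atTop (𝓝 1) := by
    have := (hm.div_atTop tendsto_log_natCast).add (tendsto_critTime_div d γ)
    rw [zero_add] at this
    refine this.congr fun n => ?_
    rw [← add_div, sub_add_cancel]
  have hlog : Tendsto (fun n : ℕ => Real.log n / n) atTop (𝓝 0) :=
    (Real.isLittleO_log_id_atTop.tendsto_div_nhds_zero).comp tendsto_natCast_atTop_atTop
  filter_upwards [hs.eventually_lt_const (one_lt_two : (1 : ℝ) < 2),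
    hs.eventually_const_lt (one_pos : (0 : ℝ) < 1),
    hlog.eventually_lt_const (one_half_pos : (0 : ℝ) < 1 / 2),
    tendsto_log_natCast.eventually_gt_atTop 0, eventually_gt_atTop 0] with n h1 h2 h3 hL hn
  have hn0 : (0 : ℝ) < n := by exact_mod_cast hn
  rw [div_lt_iff₀ hL, div_lt_iff₀ hn0] at h1
  rw [div_lt_iff₀ hn0] at h3
  constructor
  · by_contra h0
    simp [show m n = 0 by omega] at h2
  · rw [mul_comm, Real.exp_mul, Real.exp_log hn0, Real.rpow_ofNat]
    nlinarith

/-- The mean is eventually at least log² n, so the Chernoff tail n^{-κ log n} absorbs the prefactor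
e·m, with m ≤ n². -/
theorem negligible_lowCount (hd : 1 ≤ d) (hγ : (d : ℝ) + 1 < γ)
    (ht : (fun n : ℕ => (t n : ℝ)) ~[atTop] fun n : ℕ => Real.log n ^ γ) {i : ℕ} (hi : i ≤ d - 1)
    (hm : Tendsto (fun n : ℕ => (m n : ℝ) / n - critTime d γ n) atTop (𝓝 c)) {y : ℝ} (hy : 0 < y)
    (hy1 : y ≠ 1) (p : ℕ → ℕ → Prop)
    (hp : ∀ n z, p n z → Real.log y * (y * lowMean n (m n) i) ≤ Real.log y * z) :
    Negligible fun n => {ω | p n (lowCount i (balls ω (m n)))} := by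
  classical
  have hκ := mul_log_sub_add_one_pos hy hy1
  set κ := y * Real.log y - y + 1
  refine Negligible.of_exp_le (K := Real.exp 1) (p := 2) hκ ?_
  have h1 := (tendsto_f_div_sq hd hγ ht i).atTop_mul_pos (Real.exp_pos _)
    (tendsto_lowMean_div hd ht hi hm)
  filter_upwards [h1.eventually_ge_atTop 1, eventually_le_sq hm,
    tendsto_log_natCast.eventually_gt_atTop 0, eventually_ge_atTop 1,
    (tendsto_f hd hγ ht i).eventually_gt_atTop 0] with n h1 h2 hL hn hf
  refine (ballLaw_lowCount_deviation_le hn h2.1 i hy (p n) (hp n)).trans ?_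
  have h3 : Real.log n ^ 2 ≤ lowMean n (m n) i := by
    rw [div_mul_div_comm, mul_comm, mul_div_mul_right _ _ hf.ne', le_div_iff₀ (by positivity),
      one_mul] at h1
    exact h1
  have h4 := h2.2
  gcongr

theorem negligible_lowCount_gt (hd : 1 ≤ d) (hγ : (d : ℝ) + 1 < γ)
    (ht : (fun n : ℕ => (t n : ℝ)) ~[atTop] fun n : ℕ => Real.log n ^ γ) {i : ℕ} (hi : i ≤ d - 1)
    (hm : Tendsto (fun n : ℕ => (m n : ℝ) / n - critTime d γ n) atTop (𝓝 c)) {q : ℝ}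
    (hq : Real.exp (-c) < q) :
    Negligible fun n => {ω | q * f d i (t n) n < lowCount i (balls ω (m n))} := by
  have hq' : 1 < q * Real.exp c := by
    have := mul_lt_mul_of_pos_right hq (Real.exp_pos c)
    rwa [← Real.exp_add, neg_add_cancel, Real.exp_zero] at this
  -- The mean is asymptotic to e^{-c} f, so y below q e^c leaves room for y times the mean to stay
  -- below q f, while y > 1 gives exponential decay.
  obtain ⟨y, hy1, hyq⟩ := exists_between hq'
  refine (negligible_lowCount hd hγ ht hi hm (zero_lt_one.trans hy1) hy1.ne'
    (fun n z => y * lowMean n (m n) i ≤ z) fun n z hz =>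
      mul_le_mul_of_nonneg_left hz (Real.log_nonneg hy1.le)).mono ?_
  have h1 := (tendsto_lowMean_div hd ht hi hm).const_mul y
  have h2 : y * Real.exp (-c) < q := by
    have := mul_lt_mul_of_pos_right hyq (Real.exp_pos (-c))
    rwa [mul_assoc q, ← Real.exp_add, add_neg_cancel, Real.exp_zero, mul_one] at this
  filter_upwards [h1.eventually_lt_const h2, (tendsto_f hd hγ ht i).eventually_gt_atTop 0]
    with n h3 hf ω hω
  rw [← mul_div_assoc, div_lt_iff₀ hf] at h3
  exact h3.le.trans (le_of_lt hω)

theorem negligible_lowCount_lt (hd : 1 ≤ d) (hγ : (d : ℝ) + 1 < γ)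
    (ht : (fun n : ℕ => (t n : ℝ)) ~[atTop] fun n : ℕ => Real.log n ^ γ) {i : ℕ} (hi : i ≤ d - 1)
    (hm : Tendsto (fun n : ℕ => (m n : ℝ) / n - critTime d γ n) atTop (𝓝 c)) {q : ℝ} (hq0 : 0 < q)
    (hq : q < Real.exp (-c)) :
    Negligible fun n => {ω | (lowCount i (balls ω (m n)) : ℝ) < q * f d i (t n) n} := by
  have hq' : q * Real.exp c < 1 := by
    have := mul_lt_mul_of_pos_right hq (Real.exp_pos c)
    rwa [← Real.exp_add, neg_add_cancel, Real.exp_zero] at this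
  obtain ⟨y, hyq, hy1⟩ := exists_between hq'
  have hy0 : 0 < y := (mul_pos hq0 (Real.exp_pos c)).trans hyq
  refine (negligible_lowCount hd hγ ht hi hm hy0 hy1.ne
    (fun n z => z ≤ y * lowMean n (m n) i) fun n z hz =>
      mul_le_mul_of_nonpos_left hz (Real.log_nonpos hy0.le hy1.le)).mono ?_
  have h1 := (tendsto_lowMean_div hd ht hi hm).const_mul y
  have h2 : q < y * Real.exp (-c) := by
    have := mul_lt_mul_of_pos_right hyq (Real.exp_pos (-c))
    rwa [mul_assoc q, ← Real.exp_add, add_neg_cancel, Real.exp_zero, mul_one] at this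
  filter_upwards [h1.eventually_const_lt h2, (tendsto_f hd hγ ht i).eventually_gt_atTop 0]
    with n h3 hf ω hω
  rw [← mul_div_assoc, lt_div_iff₀ hf] at h3
  exact (le_of_lt hω).trans h3.le

/-- The threshold log² n is large enough for 2^{-log² n} to beat n² times n^{d²}, yet is o(f_i) for
every i. -/
theorem negligible_badCount (hd : 1 ≤ d)
    (hm : Tendsto (fun n : ℕ => (m n : ℝ) / n - critTime d γ n) atTop (𝓝 c)) :
    Negligible fun n => {ω | ∃ j ≤ m n,
      ⌈Real.log n ^ 2⌉₊ ≤ badCount d (State.empty n) (balls ω j) ∧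
        d ^ 2 ≤ (state d ω j).deficit d} := by
  refine Negligible.of_exp_le (K := 2 * (d : ℝ) ^ d ^ 2) (p := 2 + (d ^ 2 : ℕ))
    (Real.log_pos one_lt_two) ?_
  filter_upwards [eventually_le_sq hm, eventually_ge_atTop 1] with n h1 hn
  have hn0 : (0 : ℝ) < n := by exact_mod_cast hn
  refine (ballLaw_exists_badCount_ge hd hn (m n) _).trans ?_
  have h2 : (1 : ℝ) ≤ m n := by exact_mod_cast h1.1
  have h3 : Real.exp (Real.log 2 * Real.log n ^ 2) ≤ (2 : ℝ) ^ ⌈Real.log n ^ 2⌉₊ := by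
    rw [← Real.rpow_natCast 2, Real.rpow_def_of_pos two_pos, Real.exp_le_exp]
    exact mul_le_mul_of_nonneg_left (Nat.le_ceil _) (Real.log_nonneg one_le_two)
  have h4 : Real.exp ((d ^ 2 : ℕ) * Real.log n) = (n : ℝ) ^ d ^ 2 := by
    rw [Real.exp_nat_mul, Real.exp_log hn0]
  have h5 := h1.2
  rw [Real.exp_neg, add_mul 2, Real.exp_add, h4]
  push_cast
  rw [mul_pow, div_eq_mul_inv]
  calc ((m n : ℝ) + 1) * ((d : ℝ) ^ d ^ 2 * n ^ d ^ 2 * (2 ^ ⌈Real.log n ^ 2⌉₊)⁻¹)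
      ≤ (2 * Real.exp (2 * Real.log n)) * ((d : ℝ) ^ d ^ 2 * n ^ d ^ 2
          * (Real.exp (Real.log 2 * Real.log n ^ 2))⁻¹) := by
        gcongr
        linarith
    _ = _ := by ring

end

/-! ### Bracketing the first time of deficit t -/

/-- The number of balls corresponding to the time `critTime d γ n + δ`. -/
noncomputable def critBalls (d : ℕ) (γ δ : ℝ) (n : ℕ) : ℕ := ⌈n * (critTime d γ n + δ)⌉₊

theorem tendsto_critBalls (d : ℕ) (γ δ : ℝ) :
    Tendsto (fun n : ℕ => (critBalls d γ δ n : ℝ) / n - critTime d γ n) atTop (𝓝 δ) := by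
  have h1 : Tendsto (fun n : ℕ => critTime d γ n) atTop atTop := by
    refine ((tendsto_critTime_div d γ).pos_mul_atTop one_pos tendsto_log_natCast).congr' ?_
    filter_upwards [tendsto_log_natCast.eventually_gt_atTop 0] with n hn
    rw [div_mul_cancel₀ _ hn.ne']
  have h2 : Tendsto (fun n : ℕ => δ + 1 / (n : ℝ)) atTop (𝓝 (δ + 0)) :=
    tendsto_const_nhds.add tendsto_one_div_atTop_nhds_zero_nat
  rw [add_zero] at h2
  refine tendsto_of_tendsto_of_tendsto_of_le_of_le' tendsto_const_nhds h2 ?_ ?_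
  · filter_upwards [eventually_gt_atTop 0] with n hn
    have hn0 : (0 : ℝ) < n := by exact_mod_cast hn
    rw [le_sub_iff_add_le, le_div_iff₀ hn0, add_comm, mul_comm]
    exact Nat.le_ceil _
  · filter_upwards [eventually_gt_atTop 0, h1.eventually_ge_atTop (-δ)] with n hn h
    have hn0 : (0 : ℝ) < n := by exact_mod_cast hn
    have h3 := (Nat.ceil_lt_add_one (a := n * (critTime d γ n + δ))
      (mul_nonneg hn0.le (by linarith))).le
    rw [sub_le_iff_le_add, div_le_iff₀ hn0]
    refine h3.trans_eq ?_
    field_simp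
    ring

section

variable {n : ℕ}

theorem valid_state (d : ℕ) (ω : ℕ → Fin n) (m : ℕ) : (state d ω m).Valid d := by
  rw [state_eq_run]
  exact Valid_run (Valid_empty d) _

theorem two_mul_card_edges_le (d : ℕ) (ω : ℕ → Fin n) (m : ℕ) :
    2 * (state d ω m).edges.card ≤ d * n := by
  have := sum_lowDegree (valid_state d ω m)
  omega

theorem deficit_eq (d : ℕ) (ω : ℕ → Fin n) (m : ℕ) :
    deficit d ω m = ((state d ω m).deficit d : ℤ) := by
  have := two_mul_card_edges_le d ω m
  unfold deficit State.deficit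
  omega

theorem deficit_succ_ge (d : ℕ) (ω : ℕ → Fin n) (m : ℕ) :
    (state d ω m).deficit d ≤ (state d ω (m + 1)).deficit d + 1 := by
  have h1 : (state d ω (m + 1)).edges.card ≤ (state d ω m).edges.card + 1 := by
    change ((state d ω m).drop d (ω m)).edges.card ≤ _
    rcases drop_cases d (state d ω m) (ω m) with ⟨-, -, e⟩ | ⟨-, -, -, e⟩ | ⟨u, -, -, -, e⟩ |
      ⟨u, -, -, -, -, -, e⟩ <;> rw [e]
    · exact Nat.le_succ _
    · exact Nat.le_succ _
    · exact Nat.le_succ _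
    · exact Finset.card_insert_le _ _
  unfold State.deficit
  omega

theorem sum_lowDegree_eq (d : ℕ) (ω : ℕ → Fin n) (m : ℕ) :
    2 * (state d ω m).deficit d ≤ ∑ i ∈ Finset.range d, (state d ω m).lowDegree i ∧
    ∑ i ∈ Finset.range d, (state d ω m).lowDegree i ≤ 2 * (state d ω m).deficit d + 1 := by
  have h1 := sum_lowDegree (valid_state d ω m)
  unfold State.deficit
  omega

/-- A process that takes few bins to be low at `b` and many at `a` reaches the deficit `t`
for the first time between `a` and `b`, with few bad pairs. -/
theorem exists_first_deficit {d t a b B : ℕ} {ω : ℕ → Fin n} (ht : t ≤ d * n / 2) (htd : d ^ 2 ≤ t)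
    (hB : ∀ m ≤ b, d ^ 2 ≤ (state d ω m).deficit d → badCount d (State.empty n) (balls ω m) < B)
    (ha : 2 * t + 1 < ∑ i ∈ Finset.range d, lowCount i (balls ω a))
    (hb : ∑ i ∈ Finset.range d, lowCount i (balls ω b) + 2 * B + 1 ≤ 2 * t) :
    Reaches d t ω ∧ ∃ M, sInf {m | deficit d ω m = t} = M ∧
      ∀ i < d, lowCount i (balls ω b) ≤ (state d ω M).lowDegree i ∧
        (state d ω M).lowDegree i ≤ lowCount i (balls ω a) + 2 * B + 1 := by
  -- A deficit above t at time b would be at least d², hence leave fewer than B bad pairs, and then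
  -- `dn_le_sum_lowCount` forces it to be at most t.
  have hsmall : ∃ m ≤ b, (state d ω m).deficit d ≤ t := by
    by_contra! h
    have h1 := h b le_rfl
    have h2 := hB b le_rfl (htd.trans h1.le)
    have h3 := dn_le_sum_lowCount d (balls ω b)
    rw [← state_eq_run] at h3
    unfold State.deficit at h1
    omega
  have hex : ∃ m, (state d ω m).deficit d ≤ t := hsmall.imp fun m h => h.2
  -- The deficit starts at ⌊dn/2⌋ ≥ t and falls by at most one per ball, so it does not jump over t.
  have hM : deficit d ω (Nat.find hex) = t := by
    have h1 := Nat.find_spec hex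
    rw [deficit_eq]
    norm_cast
    refine le_antisymm h1 ?_
    rcases Nat.eq_zero_or_pos (Nat.find hex) with h0 | h0
    · rw [h0]
      simpa [state, State.deficit] using ht
    · have h2 := Nat.find_min hex (Nat.sub_lt h0 one_pos)
      have h3 := deficit_succ_ge d ω (Nat.find hex - 1)
      rw [Nat.sub_add_cancel h0] at h3
      omega
  have hMb : Nat.find hex ≤ b := by
    obtain ⟨m, hm, h⟩ := hsmall
    exact (Nat.find_min' hex h).trans hm
  have hT : (state d ω (Nat.find hex)).deficit d = t := by
    rw [deficit_eq] at hM
    exact_mod_cast hM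
  have haM : a ≤ Nat.find hex := by
    by_contra! h
    have h1 := (sum_lowDegree_eq d ω (Nat.find hex)).2
    have h2 : ∑ i ∈ Finset.range d, lowCount i (balls ω a)
        ≤ ∑ i ∈ Finset.range d, (state d ω (Nat.find hex)).lowDegree i := by
      refine Finset.sum_le_sum fun i _ => ?_
      rw [state_eq_run]
      exact (lowCount_anti fun v => count_balls_mono ω v h.le).trans (lowCount_le_lowDegree d i _)
    omega
  have hBM := hB _ hMb (htd.trans_eq hT.symm)
  refine ⟨⟨_, hM⟩, Nat.find hex, ?_, fun i hi => ?_⟩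
  · refine le_antisymm (Nat.sInf_le hM) (le_csInf ⟨_, hM⟩ fun j hj => Nat.find_min' hex ?_)
    have hj' : deficit d ω j = t := hj
    rw [deficit_eq] at hj'
    exact_mod_cast hj'.le
  · rw [state_eq_run]
    constructor
    · exact (lowCount_anti fun v => count_balls_mono ω v hMb).trans (lowCount_le_lowDegree d i _)
    · have h1 := lowDegree_le_lowCount hi (balls ω (Nat.find hex))
      have h2 := lowCount_anti (i := i) fun v => count_balls_mono ω v haM
      omega

theorem degreeCount_zero (d : ℕ) (ω : ℕ → Fin n) (m : ℕ) :
    degreeCount d 0 ω m = (state d ω m).lowDegree 0 := by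
  simp [degreeCount, State.lowDegree]

theorem degreeCount_succ (d i : ℕ) (ω : ℕ → Fin n) (m : ℕ) :
    degreeCount d (i + 1) ω m + (state d ω m).lowDegree i = (state d ω m).lowDegree (i + 1) := by
  unfold degreeCount State.lowDegree
  rw [← Finset.card_union_of_disjoint]
  · congr 1
    ext v
    simp
    omega
  · rw [Finset.disjoint_filter]
    intros
    omega

theorem degreeCount_le_lowDegree (d i : ℕ) (ω : ℕ → Fin n) (m : ℕ) :
    degreeCount d i ω m ≤ (state d ω m).lowDegree i :=
  Finset.card_le_card fun v => by
    simp
    omega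

/-- Crude deterministic bound controlling the expectation on the exceptional event. -/
theorem degreeCountAt_le {d i : ℕ} (hi : i < d) (t : ℕ) (ω : ℕ → Fin n) :
    degreeCountAt d i t ω ≤ 2 * t + 1 := by
  unfold degreeCountAt
  split_ifs with h
  · have hM : deficit d ω (sInf {m | deficit d ω m = t}) = t :=
      Nat.sInf_mem (s := {m | deficit d ω m = t}) h
    rw [deficit_eq] at hM
    have h1 := (sum_lowDegree_eq d ω (sInf {m | deficit d ω m = t})).2
    have h2 := degreeCount_le_lowDegree d i ω (sInf {m | deficit d ω m = t})
    have h3 := Finset.single_le_sum (s := Finset.range d)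
      (f := fun i => (state d ω (sInf {m | deficit d ω m = t})).lowDegree i)
      (fun _ _ => Nat.zero_le _) (Finset.mem_range.2 hi)
    omega
  · exact Nat.zero_le _

end

/-! ### Concentration of the degree counts -/

section

variable {d : ℕ} {γ : ℝ} {t : ℕ → ℕ}

theorem eventually_t_le (ht : (fun n : ℕ => (t n : ℝ)) ~[atTop] fun n : ℕ => Real.log n ^ γ)
    (hd : 2 ≤ d) : ∀ᶠ n in atTop, t n ≤ d * n / 2 := by
  have h1 : Tendsto (fun n : ℕ => Real.log n ^ γ / n) atTop (𝓝 0) :=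
    ((isLittleO_log_rpow_rpow_atTop γ one_pos).tendsto_div_nhds_zero.comp
      tendsto_natCast_atTop_atTop).congr fun n => by simp
  have h2 := (tendsto_t_div ht).mul h1
  rw [mul_zero] at h2
  filter_upwards [h2.eventually_lt_const one_pos, tendsto_log_natCast.eventually_gt_atTop 0,
    eventually_gt_atTop 0] with n h hL hn
  have hn0 : (0 : ℝ) < n := by exact_mod_cast hn
  have := Real.rpow_pos_of_pos hL γ
  rw [div_mul_div_cancel₀ this.ne', div_lt_one hn0] at h
  have h3 : t n < n := by exact_mod_cast h
  rw [Nat.le_div_iff_mul_le two_pos]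
  nlinarith

theorem tendsto_ceil_log_sq_div (hd : 1 ≤ d) (hγ : (d : ℝ) + 1 < γ)
    (ht : (fun n : ℕ => (t n : ℝ)) ~[atTop] fun n : ℕ => Real.log n ^ γ) (i : ℕ) :
    Tendsto (fun n : ℕ => (2 * (⌈Real.log n ^ 2⌉₊ : ℝ) + 1) / f d i (t n) n) atTop (𝓝 0) := by
  have h1 := ((tendsto_f_div_sq hd hγ ht i).inv_tendsto_atTop).const_mul 2
  have h2 := (tendsto_f hd hγ ht i).const_div_atTop 3
  have h3 := h1.add h2
  rw [mul_zero, add_zero] at h3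
  refine squeeze_zero (fun n => div_nonneg (by positivity) (f_nonneg _ _ _ _)) (fun n => ?_) h3
  have h4 := (Nat.ceil_lt_add_one (sq_nonneg (Real.log n))).le
  simp only [Pi.inv_apply, inv_div]
  rw [← mul_div_assoc, ← add_div]
  refine div_le_div_of_nonneg_right ?_ (f_nonneg _ _ _ _)
  linarith

theorem tendsto_sum_f_div (hd : 1 ≤ d)
    (ht : (fun n : ℕ => (t n : ℝ)) ~[atTop] fun n : ℕ => Real.log n ^ γ) :
    Tendsto (fun n => (∑ i ∈ Finset.range d, f d i (t n) n) / (2 * t n)) atTop (𝓝 1) := by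
  have h1 : ∀ i ∈ Finset.range (d - 1), Tendsto (fun n => f d i (t n) n / (2 * t n)) atTop (𝓝 0) :=
    fun i hi => tendsto_f_div_last ht (Finset.mem_range.1 hi)
  have h2 := (tendsto_finsetSum _ h1).add_const 1
  rw [Finset.sum_const_zero, zero_add] at h2
  refine h2.congr' ?_
  filter_upwards [eventually_t_pos ht] with n h
  obtain ⟨e, rfl⟩ := Nat.exists_eq_add_of_le' hd
  rw [Finset.sum_range_succ, add_div, Finset.sum_div]
  have h3 := f_pred (e + 1) (t n) n
  simp only [Nat.add_sub_cancel] at h3 ⊢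
  rw [h3, div_self (by positivity)]

/-- Concentration of the degree counts. -/
theorem negligible_degreeCountAt (hd : 2 ≤ d) (hγ : (d : ℝ) + 1 < γ)
    (ht : (fun n : ℕ => (t n : ℝ)) ~[atTop] fun n : ℕ => Real.log n ^ γ) {i : ℕ} (hi : i ≤ d - 1)
    {ε : ℝ} (hε : 0 < ε) :
    Negligible fun n => {ω | ¬ (Reaches d (t n) ω ∧
      |(degreeCountAt d i (t n) ω : ℝ) - f d i (t n) n| ≤ ε * f d i (t n) n)} := by
  have hd1 : 1 ≤ d := by omega
  -- Shifting time by ∓δ multiplies the means by (1 + ε/8)^{±1}. The constants ε/16 and ε/4 lie on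
  -- either side: the former brackets the time, the latter bounds the counts.
  set δ := Real.log (1 + ε / 8) with hδ
  have hexp1 : Real.exp (-(-δ)) = 1 + ε / 8 := by rw [neg_neg, hδ, Real.exp_log (by linarith)]
  have hexp2 : Real.exp (-δ) = (1 + ε / 8)⁻¹ := by
    rw [Real.exp_neg, hδ, Real.exp_log (by linarith)]
  have hma := tendsto_critBalls d γ (-δ)
  have hmb := tendsto_critBalls d γ δ
  have hle : ∀ j ∈ Finset.range d, j ≤ d - 1 := fun j hj => by
    have := Finset.mem_range.1 hj
    omega
  have N1 := negligible_badCount hd1 hmb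
  have N2 := Negligible.biUnion (Finset.range d) fun j hj =>
    negligible_lowCount_gt hd1 hγ ht (hle j hj) hma (q := 1 + ε / 4) (by rw [hexp1]; linarith)
  have N3 := Negligible.biUnion (Finset.range d) fun j hj =>
    negligible_lowCount_lt hd1 hγ ht (hle j hj) hmb (q := (1 + ε / 4)⁻¹) (by positivity)
      (by rw [hexp2]; gcongr; norm_num)
  -- Level d - 1 alone suffices at the early time, because f_{d-1} = 2t.
  have N4 := negligible_lowCount_lt hd1 hγ ht le_rfl hma (q := 1 + ε / 16) (by positivity)
      (by rw [hexp1]; linarith)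
  have N5 := Negligible.biUnion (Finset.range d) fun j hj =>
    negligible_lowCount_gt hd1 hγ ht (hle j hj) hmb (q := (1 + ε / 16)⁻¹)
      (by rw [hexp2]; gcongr; norm_num)
  refine ((((N1.union N2).union N3).union N4).union N5).mono ?_
  have L1 := ((tendsto_sum_f_div hd1 ht).const_mul ((1 + ε / 16)⁻¹)).add
    (tendsto_ceil_log_sq_div hd1 hγ ht (d - 1))
  have hr1 : (1 + ε / 16)⁻¹ * 1 + 0 < 1 := by
    rw [mul_one, add_zero]
    exact inv_lt_one_of_one_lt₀ (by linarith)
  have L2 := tendsto_ceil_log_sq_div hd1 hγ ht i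
  -- The level below i, bad-pair correction included, is negligible against f_i, so passing from
  -- cumulative to exact counts costs at most ε/4.
  have L3 : ∀ᶠ n in atTop, ∀ j, i = j + 1 →
      (1 + ε / 4) * f d j (t n) n + (2 * (⌈Real.log n ^ 2⌉₊ : ℝ) + 1)
        ≤ ε / 4 * f d i (t n) n := by
    rcases i with _ | j
    · simp
    · have h := ((tendsto_f_div_f_succ hi ht).const_mul (1 + ε / 4)).add L2
      rw [mul_zero, add_zero] at h
      filter_upwards [h.eventually_lt_const (show 0 < ε / 4 by positivity),
        (tendsto_f hd1 hγ ht (j + 1)).eventually_gt_atTop 0] with n hn hf j' hj'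
      obtain rfl : j = j' := by omega
      rw [← mul_div_assoc, ← add_div, div_lt_iff₀ hf] at hn
      exact hn.le
  have hinv : 1 - ε / 4 ≤ (1 + ε / 4)⁻¹ := by
    rw [← one_div, le_div_iff₀ (by positivity)]
    nlinarith
  filter_upwards [L1.eventually_lt_const hr1, L2.eventually_lt_const (show 0 < ε / 4 by positivity),
    -- The threshold 16/ε makes (ε/16)·2t exceed 1, which absorbs the parity term in 2t + 1.
    L3, eventually_t_le ht hd, (tendsto_f hd1 hγ ht (d - 1)).eventually_gt_atTop (16 / ε),
    (tendsto_f hd1 hγ ht (d - 1)).eventually_ge_atTop (2 * d ^ 2 : ℝ),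
    eventually_t_pos ht, (tendsto_f hd1 hγ ht i).eventually_gt_atTop 0]
    with n l1 l2 l3 htn hbig htd htpos hfpos ω hω
  by_contra hgood
  refine hω ?_
  simp only [Set.mem_union, Set.mem_iUnion, Set.mem_ofPred_eq, not_or, not_exists, not_and, not_lt,
    not_le, Finset.mem_range] at hgood
  obtain ⟨⟨⟨⟨g1, g2⟩, g3⟩, g4⟩, g5⟩ := hgood
  rw [f_pred] at hbig htd g4
  rw [f_pred, ← mul_div_assoc, ← add_div, div_lt_one (by positivity)] at l1
  rw [div_lt_iff₀ hfpos] at l2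
  have htd' : d ^ 2 ≤ t n := by
    have : (d : ℝ) ^ 2 ≤ t n := by linarith
    exact_mod_cast this
  have ha : 2 * t n + 1 < ∑ j ∈ Finset.range d, lowCount j (balls ω (critBalls d γ (-δ) n)) := by
    have h1 := Finset.single_le_sum (s := Finset.range d)
      (f := fun j => lowCount j (balls ω (critBalls d γ (-δ) n)))
      (fun _ _ => Nat.zero_le _) (Finset.mem_range.2 (show d - 1 < d by omega))
    refine lt_of_lt_of_le ?_ h1
    rw [div_lt_iff₀ hε] at hbig
    have : ((2 * t n + 1 : ℕ) : ℝ) < lowCount (d - 1) (balls ω (critBalls d γ (-δ) n)) := by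
      push_cast
      linarith
    exact_mod_cast this
  have hb : ∑ j ∈ Finset.range d, lowCount j (balls ω (critBalls d γ δ n))
      + 2 * ⌈Real.log n ^ 2⌉₊ + 1 ≤ 2 * t n := by
    have h1 : ∑ j ∈ Finset.range d, (lowCount j (balls ω (critBalls d γ δ n)) : ℝ)
        ≤ (1 + ε / 16)⁻¹ * ∑ j ∈ Finset.range d, f d j (t n) n := by
      rw [Finset.mul_sum]
      exact Finset.sum_le_sum fun j hj => g5 j (Finset.mem_range.1 hj)
    have : ((∑ j ∈ Finset.range d, lowCount j (balls ω (critBalls d γ δ n))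
      + 2 * ⌈Real.log n ^ 2⌉₊ + 1 : ℕ) : ℝ) ≤ ((2 * t n : ℕ) : ℝ) := by
      push_cast
      linarith
    exact_mod_cast this
  obtain ⟨hR, M, hM, hlow⟩ := exists_first_deficit htn htd'
    (fun m hm hdm => lt_of_not_ge fun h => absurd hdm (g1 m hm h).not_ge) ha hb
  refine ⟨hR, ?_⟩
  have hlow1 : ∀ j < d, (1 + ε / 4)⁻¹ * f d j (t n) n ≤ (state d ω M).lowDegree j := by
    intro j hj
    refine (g3 j hj).trans ?_
    exact_mod_cast (hlow j hj).1
  have hlow2 : ∀ j < d, ((state d ω M).lowDegree j : ℝ)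
      ≤ (1 + ε / 4) * f d j (t n) n + (2 * (⌈Real.log n ^ 2⌉₊ : ℝ) + 1) := by
    intro j hj
    have h1 : ((state d ω M).lowDegree j : ℝ) ≤ ((lowCount j (balls ω (critBalls d γ (-δ) n))
      + 2 * ⌈Real.log n ^ 2⌉₊ + 1 : ℕ) : ℝ) := by exact_mod_cast (hlow j hj).2
    push_cast at h1
    have := g2 j hj
    linarith
  have hid : i < d := by omega
  rw [degreeCountAt, if_pos hR, hM]
  have u1 := hlow1 i hid
  have u2 := hlow2 i hid
  have u3 : (1 - ε / 4) * f d i (t n) n ≤ (1 + ε / 4)⁻¹ * f d i (t n) n := by gcongr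
  have hεf := mul_pos hε hfpos
  rw [abs_le]
  rcases i with _ | j
  · rw [degreeCount_zero]
    constructor <;> linarith
  · have h1 : (degreeCount d (j + 1) ω M : ℝ) + (state d ω M).lowDegree j
        = (state d ω M).lowDegree (j + 1) := by exact_mod_cast degreeCount_succ d j ω M
    have h2 := hlow2 j (by omega)
    have h3 := l3 j rfl
    have h4 : (0 : ℝ) ≤ (state d ω M).lowDegree j := Nat.cast_nonneg _
    constructor <;> linarith

theorem exists_descFactorial_approx (k : ℕ) {ε : ℝ} (hε : 0 < ε) :
    ∃ η > 0, ∃ K : ℝ, ∀ (D : ℕ) (x : ℝ), K ≤ x → |(D : ℝ) - x| ≤ η * x →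
      |(D.descFactorial k : ℝ) - x ^ k| ≤ ε * x ^ k := by
  have hc1 : Tendsto (fun η : ℝ => (1 + 2 * η) ^ k) (𝓝[>] 0) (𝓝 1) := by
    have : Continuous fun η : ℝ => (1 + 2 * η) ^ k := by fun_prop
    have h := this.tendsto 0
    simp only [mul_zero, add_zero, one_pow] at h
    exact h.mono_left nhdsWithin_le_nhds
  have hc2 : Tendsto (fun η : ℝ => (1 - 2 * η) ^ k) (𝓝[>] 0) (𝓝 1) := by
    have : Continuous fun η : ℝ => (1 - 2 * η) ^ k := by fun_prop
    have h := this.tendsto 0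
    simp only [mul_zero, sub_zero, one_pow] at h
    exact h.mono_left nhdsWithin_le_nhds
  have hev := (hc1.eventually_lt_const (show 1 < 1 + ε by linarith)).and
    ((hc2.eventually_const_lt (show 1 - ε < 1 by linarith)).and
      (Ioo_mem_nhdsGT (show (0 : ℝ) < 1 / 2 by norm_num)))
  obtain ⟨η, h1, h2, hη0, hη1⟩ := hev.exists
  -- For x ≥ k/η the shift by k in (D + 1 - k)^k ≤ [D]_k ≤ D^k is at most ηx, which explains the 2η
  -- above.
  refine ⟨η, hη0, k / η, fun D x hx hD => ?_⟩
  have hkx : (k : ℝ) ≤ η * x := by rwa [div_le_iff₀' hη0] at hx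
  have hx0 : 0 ≤ x := (by positivity : (0 : ℝ) ≤ k / η).trans hx
  rw [abs_le] at hD
  have hup : (D.descFactorial k : ℝ) ≤ (1 + ε) * x ^ k := by
    calc (D.descFactorial k : ℝ) ≤ (D : ℝ) ^ k := by exact_mod_cast Nat.descFactorial_le_pow D k
      _ ≤ ((1 + 2 * η) * x) ^ k := by
        gcongr
        nlinarith
      _ = (1 + 2 * η) ^ k * x ^ k := mul_pow _ _ _
      _ ≤ (1 + ε) * x ^ k := by gcongr
  have hlo : (1 - ε) * x ^ k ≤ D.descFactorial k := by
    have h3 : (1 - 2 * η) * x ≤ ((D + 1 - k : ℕ) : ℝ) := by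
      have h4 : (D : ℝ) + 1 - k ≤ ((D + 1 - k : ℕ) : ℝ) := by
        rw [sub_le_iff_le_add]
        exact_mod_cast (show D + 1 ≤ D + 1 - k + k by omega)
      nlinarith
    calc (1 - ε) * x ^ k ≤ (1 - 2 * η) ^ k * x ^ k := by gcongr
      _ = ((1 - 2 * η) * x) ^ k := (mul_pow _ _ _).symm
      _ ≤ ((D + 1 - k : ℕ) : ℝ) ^ k := by
        refine pow_le_pow_left₀ (mul_nonneg (by linarith) hx0) h3 k
      _ ≤ D.descFactorial k := by exact_mod_cast Nat.pow_sub_le_descFactorial D k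
  rw [abs_le]
  constructor <;> linarith

/-- Concentration of the falling factorials of the degree counts. -/
theorem negligible_descFactorial (hd : 2 ≤ d) (hγ : (d : ℝ) + 1 < γ)
    (ht : (fun n : ℕ => (t n : ℝ)) ~[atTop] fun n : ℕ => Real.log n ^ γ) {i : ℕ} (hi : i ≤ d - 1)
    (k : ℕ) {ε : ℝ} (hε : 0 < ε) :
    Negligible fun n => {ω | ¬ (Reaches d (t n) ω ∧
      |((degreeCountAt d i (t n) ω).descFactorial k : ℝ) - f d i (t n) n ^ k|
        ≤ ε * f d i (t n) n ^ k)} := by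
  obtain ⟨η, hη, K, hK⟩ := exists_descFactorial_approx k hε
  refine (negligible_degreeCountAt hd hγ ht hi hη).mono ?_
  filter_upwards [(tendsto_f (by omega) hγ ht i).eventually_ge_atTop K] with n hn ω
  contrapose
  simp only [Set.mem_ofPred_eq, not_not]
  exact fun h => ⟨h.1, hK _ _ hn h.2⟩

end

/-! ### From concentration to the two assertions -/

/-- Errors that are eventually small at every fixed precision are small at a precision tending
to zero. -/
theorem exists_tendsto_zero_of_forall_eventually {P : ℕ → ℝ → Prop}
    (hmono : ∀ n a b, a ≤ b → P n a → P n b) (h : ∀ ε > 0, ∀ᶠ n in atTop, P n ε) :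
    ∃ Φ : ℕ → ℝ, Tendsto Φ atTop (𝓝 0) ∧ ∀ᶠ n in atTop, P n (Φ n) := by
  have hbdd : ∀ n, BddBelow {ε : ℝ | 0 < ε ∧ P n ε} := fun n => ⟨0, fun ε hε => hε.1.le⟩
  -- The summand 1/(n+1) is added because the infimum need not be attained.
  refine ⟨fun n => sInf {ε : ℝ | 0 < ε ∧ P n ε} + 1 / ((n : ℝ) + 1), ?_, ?_⟩
  · have h1 : Tendsto (fun n => sInf {ε : ℝ | 0 < ε ∧ P n ε}) atTop (𝓝 0) := by
      rw [tendsto_order]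
      constructor
      · exact fun a ha => .of_forall fun n => ha.trans_le (Real.sInf_nonneg fun ε hε => hε.1.le)
      · intro a ha
        filter_upwards [h (a / 2) (by linarith)] with n hn
        exact (csInf_le (hbdd n) ⟨by linarith, hn⟩).trans_lt (by linarith)
    simpa using h1.add tendsto_one_div_add_atTop_nhds_zero_nat
  · filter_upwards [h 1 one_pos] with n hn
    obtain ⟨ε, hε, hlt⟩ := exists_lt_of_csInf_lt (s := {ε : ℝ | 0 < ε ∧ P n ε}) ⟨1, one_pos, hn⟩
      (lt_add_of_pos_right _ (show (0 : ℝ) < 1 / ((n : ℝ) + 1) by positivity))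
    exact hmono n _ _ hlt.le hε.2

/-- A bound for the error of an expectation under concentration. -/
theorem abs_integral_sub_le {Ω : Type*} [MeasurableSpace Ω] (μ : Measure Ω) [IsProbabilityMeasure μ]
    {X : Ω → ℝ} (hX : Measurable X) {F a b : ℝ} (hX0 : ∀ ω, 0 ≤ X ω) (hXb : ∀ ω, X ω ≤ b)
    (hF : 0 ≤ F) (hb : F ≤ b) (ha : 0 ≤ a) :
    |∫ ω, X ω ∂μ - F| ≤ a + b * μ.real {ω | ¬ |X ω - F| ≤ a} := by
  have hset : MeasurableSet {ω | ¬ |X ω - F| ≤ a} :=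
    (measurableSet_le (hX.sub_const F).abs measurable_const).compl
  have hint : Integrable X μ := Integrable.of_bound hX.aestronglyMeasurable b
    (.of_forall fun ω => by rw [Real.norm_of_nonneg (hX0 ω)]; exact hXb ω)
  have hind : Integrable (fun ω => a + {ω | ¬ |X ω - F| ≤ a}.indicator (fun _ => b) ω) μ :=
    (integrable_const a).add ((integrable_const b).indicator hset)
  calc |∫ ω, X ω ∂μ - F| = |∫ ω, (X ω - F) ∂μ| := by
        rw [integral_sub hint (integrable_const F)]
        simp
    _ ≤ ∫ ω, |X ω - F| ∂μ := abs_integral_le_integral_abs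
    _ ≤ ∫ ω, (a + {ω | ¬ |X ω - F| ≤ a}.indicator (fun _ => b) ω) ∂μ := by
        refine integral_mono (hint.sub (integrable_const F)).abs hind fun ω => ?_
        by_cases h : |X ω - F| ≤ a
        · simp [h]
        · have h1 : |X ω - F| ≤ b := by
            rw [abs_le]
            constructor <;> linarith [hX0 ω, hXb ω]
          simp only [Set.indicator, Set.mem_ofPred_eq, h, not_false_eq_true, if_true]
          linarith
    _ = a + b * μ.real {ω | ¬ |X ω - F| ≤ a} := by
        rw [integral_add (integrable_const a) ((integrable_const b).indicator hset),
          integral_indicator_const _ hset]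
        simp [mul_comm]

theorem integral_descFactorial_isEquivalent {d : ℕ} {γ : ℝ} {t : ℕ → ℕ} (hd : 2 ≤ d)
    (hγ : (d : ℝ) + 1 < γ)
    (ht : (fun n : ℕ => (t n : ℝ)) ~[atTop] fun n : ℕ => Real.log n ^ γ) {i : ℕ} (hi : i ≤ d - 1)
    (k : ℕ) :
    (fun n : ℕ => ∫ ω, ((degreeCountAt d i (t n) ω).descFactorial k : ℝ) ∂(ballLaw n))
      ~[atTop] fun n : ℕ => f d i (t n) n ^ k := by
  refine isLittleO_iff.2 fun ε hε => ?_
  have hN := negligible_descFactorial hd hγ ht hi k (half_pos hε)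
  -- The exponent (d-1-i)k pays for the k-th power of (2t + 1)/f_i, which is at most 2 log^{d-1-i}
  -- n; exponent 0 handles the remaining f_i^k.
  have h1 := ((hN (((d - 1 - i) * k : ℕ) : ℝ)).const_mul (2 ^ k)).add (hN 0)
  rw [mul_zero, add_zero] at h1
  filter_upwards [h1.eventually_lt_const (half_pos hε), eventually_ge_atTop 1,
    tendsto_log_natCast.eventually_gt_atTop 0, eventually_t_pos ht,
    (tendsto_f (by omega) hγ ht i).eventually_gt_atTop 0] with n hP hn hL htpos hf
  have := isProbabilityMeasure_ballLaw hn
  have hmeas : Measurable fun ω : ℕ → Fin n =>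
      ((degreeCountAt d i (t n) ω).descFactorial k : ℝ) :=
    (measurable_of_countable fun D : ℕ => (D.descFactorial k : ℝ)).comp
      (measurable_degreeCountAt d i (t n))
  have hF : 0 ≤ f d i (t n) n ^ k := by positivity
  -- The term f_i^k is added only so that the bound also dominates the target value.
  have hbound : ∀ ω : ℕ → Fin n, ((degreeCountAt d i (t n) ω).descFactorial k : ℝ)
      ≤ (2 * t n + 1 : ℝ) ^ k + f d i (t n) n ^ k := by
    intro ω
    have : (degreeCountAt d i (t n) ω).descFactorial k ≤ (2 * t n + 1) ^ k :=
      (Nat.descFactorial_le_pow _ _).trans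
        (Nat.pow_le_pow_left (degreeCountAt_le (by omega) (t n) ω) k)
    have : ((degreeCountAt d i (t n) ω).descFactorial k : ℝ) ≤ (2 * t n + 1 : ℝ) ^ k := by
      exact_mod_cast this
    linarith
  have h2 := abs_integral_sub_le (ballLaw n) hmeas (fun ω => Nat.cast_nonneg _) hbound hF
    (le_add_of_nonneg_left (by positivity)) (a := ε / 2 * f d i (t n) n ^ k) (by positivity)
  have h3 : (ballLaw n).real {ω | ¬ |((degreeCountAt d i (t n) ω).descFactorial k : ℝ)
        - f d i (t n) n ^ k| ≤ ε / 2 * f d i (t n) n ^ k}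
      ≤ (ballLaw n).real {ω | ¬ (Reaches d (t n) ω ∧
        |((degreeCountAt d i (t n) ω).descFactorial k : ℝ) - f d i (t n) n ^ k|
        ≤ ε / 2 * f d i (t n) n ^ k)} :=
    measureReal_mono fun ω hω h => hω h.2
  set p := (ballLaw n).real {ω | ¬ (Reaches d (t n) ω ∧
        |((degreeCountAt d i (t n) ω).descFactorial k : ℝ) - f d i (t n) n ^ k|
        ≤ ε / 2 * f d i (t n) n ^ k)}
  have h4 : (2 * t n + 1 : ℝ) ≤ 2 * Real.log n ^ (d - 1 - i) * f d i (t n) n := by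
    have h5 : (1 : ℝ) ≤ ((d - 1).descFactorial (d - 1 - i) : ℝ) := by
      exact_mod_cast Nat.descFactorial_pos.2 (Nat.sub_le _ _)
    have h6 : (1 : ℝ) ≤ t n := by exact_mod_cast Nat.one_le_iff_ne_zero.2 (by
      rintro h
      simp [h] at htpos)
    have h7 : 2 * Real.log n ^ (d - 1 - i) * f d i (t n) n
        = 4 * ((d - 1).descFactorial (d - 1 - i) : ℝ) * t n := by
      rw [f]
      field_simp
      ring
    rw [h7]
    nlinarith
  have h8 : (2 * t n + 1 : ℝ) ^ k
      ≤ 2 ^ k * Real.log n ^ ((d - 1 - i) * k) * f d i (t n) n ^ k := by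
    calc (2 * t n + 1 : ℝ) ^ k ≤ (2 * Real.log n ^ (d - 1 - i) * f d i (t n) n) ^ k := by gcongr
      _ = _ := by rw [mul_pow, mul_pow, pow_mul]
  rw [Real.rpow_natCast, Real.rpow_zero, mul_one] at hP
  rw [Real.norm_of_nonneg hF, Pi.sub_apply, Real.norm_eq_abs]
  have hp0 : 0 ≤ p := measureReal_nonneg
  refine h2.trans ?_
  calc ε / 2 * f d i (t n) n ^ k + ((2 * t n + 1 : ℝ) ^ k + f d i (t n) n ^ k) * _
      ≤ ε / 2 * f d i (t n) n ^ k
        + (2 ^ k * Real.log n ^ ((d - 1 - i) * k) * f d i (t n) n ^ k + f d i (t n) n ^ k) * p := by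
        gcongr
    _ = (ε / 2 + (2 ^ k * (p * Real.log n ^ ((d - 1 - i) * k)) + p)) * f d i (t n) n ^ k := by ring
    _ ≤ (ε / 2 + ε / 2) * f d i (t n) n ^ k := by gcongr
    _ = ε * f d i (t n) n ^ k := by ring

end BinProcess

theorem theorem5p2 (d : ℕ) (hd : 2 ≤ d) (γ : ℝ) (hγ : (d : ℝ) + 1 < γ) (t : ℕ → ℕ)
    (ht : (fun n : ℕ => (t n : ℝ)) ~[atTop] fun n : ℕ => Real.log n ^ γ)
    (i : ℕ) (hi : i ≤ d - 1) (k : ℕ) (hk : 1 ≤ k) :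
    (∀ C : ℝ, 0 < C → ∃ Φ : ℕ → ℝ, Tendsto Φ atTop (𝓝 0) ∧
      (fun n : ℕ => (BinProcess.ballLaw n).real
        {ω | ¬ (BinProcess.Reaches d (t n) ω ∧
          |((BinProcess.degreeCountAt d i (t n) ω).descFactorial k : ℝ)
              - BinProcess.f d i (t n) n ^ k| ≤ Φ n * BinProcess.f d i (t n) n ^ k)})
        =O[atTop] fun n : ℕ => Real.log n ^ (-C)) ∧
    ((fun n : ℕ => ∫ ω, ((BinProcess.degreeCountAt d i (t n) ω).descFactorial k : ℝ)
        ∂(BinProcess.ballLaw n))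
      ~[atTop] fun n : ℕ => BinProcess.f d i (t n) n ^ k) := by
  refine ⟨fun C _ => ?_, BinProcess.integral_descFactorial_isEquivalent hd hγ ht hi k⟩
  obtain ⟨Φ, hΦ, h⟩ := BinProcess.exists_tendsto_zero_of_forall_eventually
    -- The guard `1 ≤ n` makes `ballLaw n` a probability measure, which monotonicity in ε uses.
    (P := fun n ε => 1 ≤ n → (BinProcess.ballLaw n).real
        {ω | ¬ (BinProcess.Reaches d (t n) ω ∧
          |((BinProcess.degreeCountAt d i (t n) ω).descFactorial k : ℝ)
              - BinProcess.f d i (t n) n ^ k| ≤ ε * BinProcess.f d i (t n) n ^ k)}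
        ≤ Real.log n ^ (-C))
    (fun n a b hab ha hn => by
      have := BinProcess.isProbabilityMeasure_ballLaw hn
      refine (measureReal_mono ?_).trans (ha hn)
      refine fun ω hω hω' => hω ⟨hω'.1, hω'.2.trans ?_⟩
      exact mul_le_mul_of_nonneg_right hab (pow_nonneg (BinProcess.f_nonneg _ _ _ _) k))
    (fun ε hε => by
      filter_upwards [(BinProcess.negligible_descFactorial hd hγ ht hi k hε).eventually_le C]
        with n hn _ using hn)
  refine ⟨Φ, hΦ, Asymptotics.IsBigO.of_bound 1 ?_⟩
  filter_upwards [h, eventually_ge_atTop 1] with n hn hn1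
  rw [Real.norm_of_nonneg measureReal_nonneg,
    Real.norm_of_nonneg (BinProcess.log_natCast_rpow_nonneg n _), one_mul]
  exact hn hn1
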